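/- Let $S^1=\{z\in\mathbb C:|z|=1\}$, let $t\ge 0$, and let $\mathcal D$ be a Borel probability distribution on $(S^1)^t$ such that, with probability $1$, any finite number of independent samples from $\mathcal D$ are pairwise distinct. For $N\ge 1$ let $\{|\psi_i\rangle\}_{i=1}^N$ be a random real orthonormal basis of $\mathbb C^N$ (the columns of a Haar-random real orthogonal matrix), let $v_i=(z_{i1},\dots,z_{it})$, $i=1,\dots,N$, be i.i.d. samples from $\mathcal D$, independent of the basis, and let $U_1,\dots,U_t$ be the commuting unitary operators on $\mathbb C^N$ with $U_j|\psi_i\rangle=z_{ij}|\psi_i\rangle$. A circuit $C$ acts on three output registers $\mathbb C^N$, any finite number of further registers $\mathbb C^N$, and any finite number of qubits. It starts in the state $|0\rangle$ and is a finite sequence of gates, each of which is either an arbitrary unitary operator on the whole space that does not depend on the $U_j$ (a standard gate), or a controlled $U_j$ gate, that is, $U_j$ applied to one of the registers $\mathbb C^N$ and controlled by one of the qubits. The probability that $C$ outputs a triple eigenstate, for given $U_1,\dots,U_t$, is $\|P\,C(U_1,\dots,U_t)|0\rangle\|^2$, where $P$ is the orthogonal projection onto the span of the states $|\psi\rangle|\psi\rangle|\psi\rangle|w\rangle$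 with $|\psi\rangle$ an eigenvector of all the $U_j$ placed in the three output registers and $|w\rangle$ an arbitrary state of the rest. When the $v_i$ are distinct this equals $\sum_{i=1}^N\|(\langle\psi_i|\langle\psi_i|\langle\psi_i|\otimes I)\,C(U_1,\dots,U_t)|0\rangle\|^2$. There is an absolute constant $\kappa>0$ such that for all such $t$ and $\mathcal D$, all $N\ge 1$, all integers $d\ge 2$ with $$d^3<\frac{N}{16\log N},$$ and every circuit $C$ with at most $d$ controlled $U_j$ gates, the probability that $C$ outputs a triple eigenstate is an integrable function of the random instance, and its expectation over the random basis and the random $v_i$ is at most $$\kappa\,\frac{d^3\log d}{N}.$$ -/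

import Mathlib

open MeasureTheory

noncomputable section

namespace BlackBoxMoney

/-- The Borel sigma-algebra on the unit circle. -/
instance : MeasurableSpace Circle := borel Circle

instance : BorelSpace Circle := ⟨rfl⟩

/-- The Borel sigma-algebra on the real orthogonal group. -/
instance (N : ℕ) : MeasurableSpace (Matrix.orthogonalGroup (Fin N) ℝ) := borel _

instance (N : ℕ) : BorelSpace (Matrix.orthogonalGroup (Fin N) ℝ) := ⟨rfl⟩

instance (N : ℕ) : CompactSpace (Matrix.orthogonalGroup (Fin N) ℝ) := by
  refine isCompact_iff_compactSpace.mp ?_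
  have hK : IsCompact (Set.univ.pi fun _ : Fin N => Set.univ.pi fun _ : Fin N =>
      Set.Icc (-1 : ℝ) 1) :=
    isCompact_univ_pi fun _ => isCompact_univ_pi fun _ => isCompact_Icc
  refine IsCompact.of_isClosed_subset hK
    (isClosed_unitary (R := Matrix (Fin N) (Fin N) ℝ)) ?_
  intro A hA i _ j _
  exact abs_le.mp (entry_norm_bound_of_unitary hA i j)

/-- The Haar probability measure on the real orthogonal group (the Haar measure normalised so that
the whole group has mass one). The columns of a sample are a random real orthonormal basis. -/
def haarOrthogonal (N : ℕ) : Measure (Matrix.orthogonalGroup (Fin N) ℝ) :=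
  Measure.haarMeasure ⊤

/-- The `i`-th basis vector of the real orthonormal basis of `ℂ^N` encoded by `O`: the `i`-th
column of `O`. -/
def basisVec {N : ℕ} (O : Matrix.orthogonalGroup (Fin N) ℝ) (i : Fin N) : Fin N → ℂ :=
  fun k => ((O.1 k i : ℝ) : ℂ)

/-- The operators `U_1, …, U_t` with real eigenbasis the columns of `O` and eigenvalue vectors
`v_i = (z i 1, …, z i t)`, that is, `U_j = O diag(z 1 j, …, z N j) Oᵀ`. -/
def operators {t N : ℕ} (O : Matrix.orthogonalGroup (Fin N) ℝ) (z : Fin N → Fin t → Circle)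
    (j : Fin t) : Matrix (Fin N) (Fin N) ℂ :=
  (O.1.map Complex.ofReal) * Matrix.diagonal (fun i => (z i j : ℂ)) * (O.1.map Complex.ofReal).transpose

/-- The defining equations `U_j ψ_i = z_{ij} ψ_i`. -/
theorem operators_mulVec_basisVec {t N : ℕ} (O : Matrix.orthogonalGroup (Fin N) ℝ)
    (z : Fin N → Fin t → Circle) (j : Fin t) (i : Fin N) :
    (operators O z j).mulVec (basisVec O i) = (z i j : ℂ) • basisVec O i := by
  have hO : O.1.transpose * O.1 = 1 := by
    have := (Matrix.mem_unitaryGroup_iff').mp O.2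
    simpa [Matrix.star_eq_conjTranspose] using this
  have h1 : (O.1.map Complex.ofReal).transpose * O.1.map Complex.ofReal = 1 := by
    have h := congrArg (fun A : Matrix (Fin N) (Fin N) ℝ => A.map Complex.ofRealHom) hO
    simp only [Matrix.map_mul] at h
    rw [Matrix.map_one _ (map_zero _) (map_one _)] at h
    exact h
  have hb : basisVec O i = (O.1.map Complex.ofReal).mulVec (Pi.single i 1) := by
    ext k; simp [basisVec]
  rw [hb, operators, Matrix.mulVec_mulVec, Matrix.mul_assoc, h1, Matrix.mul_one,
    ← Matrix.mulVec_mulVec]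
  have h2 : (Matrix.diagonal fun i => (z i j : ℂ)).mulVec (Pi.single i 1)
      = (z i j : ℂ) • (Pi.single i 1 : Fin N → ℂ) := by
    ext k
    by_cases hk : k = i
    · subst hk; simp [Matrix.mulVec_diagonal]
    · simp [Matrix.mulVec_diagonal, hk]
  rw [h2, Matrix.mulVec_smul]

/-- The law of a random instance: a Haar-random real orthonormal basis and, independently of it,
`N` i.i.d. eigenvalue vectors with law `D`. -/
def instanceLaw {t : ℕ} (D : Measure (Fin t → Circle)) (N : ℕ) :
    Measure (Matrix.orthogonalGroup (Fin N) ℝ × (Fin N → Fin t → Circle)) :=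
  (haarOrthogonal N).prod (Measure.pi fun _ => D)

/-- Labels of the computational basis of a machine with `3` output registers and `r` further
registers, each holding a vector of `ℂ^N`, and with `m` qubits. -/
abbrev Config (N r m : ℕ) : Type := (Fin 3 ⊕ Fin r → Fin N) × (Fin m → Bool)

/-- State space `(ℂ^N)^{⊗ 3} ⊗ (ℂ^N)^{⊗ r} ⊗ (ℂ²)^{⊗ m}` of the machine. -/
abbrev State (N r m : ℕ) : Type := EuclideanSpace ℂ (Config N r m)

/-- A gate is either a standard gate, which may be any fixed unitary operator on the machine (chosen
without reference to the operators `U_j`), or a query: `U_j` applied to register `s`, controlled by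
the qubit `c`. -/
inductive Gate (t N r m : ℕ) : Type
  | standard (W : Matrix.unitaryGroup (Config N r m) ℂ) : Gate t N r m
  | controlled (j : Fin t) (c : Fin m) (s : Fin 3 ⊕ Fin r) : Gate t N r m

/-- Whether a gate is a controlled `U_j` gate. -/
def Gate.isQuery {t N r m : ℕ} : Gate t N r m → Bool
  | .standard _ => false
  | .controlled _ _ _ => true

/-- Action of a gate on states, for given operators `U_1, …, U_t`. -/
def Gate.apply {t N r m : ℕ} (U : Fin t → Matrix (Fin N) (Fin N) ℂ) :
    Gate t N r m → State N r m → State N r m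
  | .standard W, Φ => WithLp.toLp 2 (W.1.mulVec Φ.ofLp)
  | .controlled j c s, Φ => WithLp.toLp 2 fun x =>
      if x.2 c = true then ∑ k : Fin N, U j (x.1 s) k * Φ (Function.update x.1 s k, x.2) else Φ x

/-- A circuit is a finite sequence of gates, the head of the list acting first. -/
abbrev Circuit (t N r m : ℕ) : Type := List (Gate t N r m)

/-- The number of controlled `U_j` gates of a circuit. -/
def Circuit.queries {t N r m : ℕ} (C : Circuit t N r m) : ℕ := List.countP Gate.isQuery C

/-- The initial state `|0⟩`. -/
def initialState (N r m : ℕ) [NeZero N] : State N r m :=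
  EuclideanSpace.single ((fun _ => 0), (fun _ => false)) 1

/-- The final state `C(U_1, …, U_t)|0⟩` of a circuit. -/
def Circuit.output {t N r m : ℕ} [NeZero N] (C : Circuit t N r m)
    (U : Fin t → Matrix (Fin N) (Fin N) ℂ) : State N r m :=
  List.foldl (fun Φ g => Gate.apply U g Φ) (initialState N r m) C

/-- `ψ` is an eigenvector of all the `U_j`. -/
def IsCommonEigenvector {t N : ℕ} (U : Fin t → Matrix (Fin N) (Fin N) ℂ) (ψ : Fin N → ℂ) : Prop :=
  ψ ≠ 0 ∧ ∀ j, ∃ μ : ℂ, (U j).mulVec ψ = μ • ψ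

/-- The state `|ψ⟩|ψ⟩|ψ⟩|w⟩`: three copies of `ψ` in the output registers, and `w` in the remaining
registers and qubits. -/
def tripleState {N r m : ℕ} (ψ : Fin N → ℂ) (w : (Fin r → Fin N) × (Fin m → Bool) → ℂ) :
    State N r m :=
  WithLp.toLp 2 fun x =>
    ψ (x.1 (Sum.inl 0)) * ψ (x.1 (Sum.inl 1)) * ψ (x.1 (Sum.inl 2)) *
      w ((fun i => x.1 (Sum.inr i)), x.2)

/-- The subspace spanned by the solutions: three copies of one common eigenvector of the `U_j` in
the output registers, with anything in the rest of the machine. -/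
def solutionSpace {t N : ℕ} (r m : ℕ) (U : Fin t → Matrix (Fin N) (Fin N) ℂ) :
    Submodule ℂ (State N r m) :=
  Submodule.span ℂ {Φ | ∃ ψ w, IsCommonEigenvector U ψ ∧ Φ = tripleState ψ w}

/-- The probability that the output registers are found in a triple eigenstate at the end of the
computation (Born rule). If the common eigenspaces are the lines spanned by an orthonormal basis
`ψ_i`, this is `∑ i, ‖(⟨ψ_i|⟨ψ_i|⟨ψ_i| ⊗ 1) C(U)|0⟩‖²`. -/
def Circuit.successProb {t N r m : ℕ} [NeZero N] (C : Circuit t N r m)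
    (U : Fin t → Matrix (Fin N) (Fin N) ℂ) : ℝ :=
  ‖(solutionSpace r m U).starProjection (C.output U)‖ ^ 2

end BlackBoxMoney

end

/-! The argument is a polynomial method in the number of distinct eigenvalue vectors. Fix the basis
`O`, and let `tripleWeight` be the weight of the output on triples of equal columns of `O`. It
equals the success probability when the `v_i` are distinct (`successProb_eq_tripleWeight`), but it
also makes sense when they repeat. After at most `d` queries the amplitudes are combinations of
functions of at most `d` of the `v_i`, so `tripleWeight` is one of functions of at most `2d` of them
(`tripleWeight_mem_junta`).

Now draw only `k` samples and assign them to the basis vectors by a uniformly random colouring. The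
mean of a function of at most `2d` coordinates is then a polynomial in `1/k` of degree less than
`2d`, and its value at `0` is the true mean (`exists_polynomial_identifiedMean`). Lagrange
interpolation at `0` thus writes the true mean as a combination of repeated means at `2d` integers
`k`. For `k = ⌊D³/j²⌋`, `1 ≤ j ≤ D = 2d`, the weights are bounded by an absolute constant
(`norm_nodeWeight_le`), and the sum of weight times `k` is `O(D³)`.

It remains to bound each repeated mean by `O(k/N)` (`integral_repeatedMean_le`). Except with
probability at most `k/N`, every colour class has at least `N/(8k)` elements (`card_unbalanced_le`).
The operators are then highly degenerate: rotating the basis inside the classes changes neither them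
nor the output state, and Haar measure is invariant under such a rotation. Rotating by random signs
followed by a flat orthogonal matrix spreads the weight: by a second-moment bound for cubic
Rademacher chaos, a class of size `K` retains an `O(1/K)` fraction of the weight on its triples
(`sum_sign_tripleWeight_le`).

Summing over the nodes gives `O(d³/N)`; the factor `log d` only enters through `log d ≥ 1/2`. -/

/-! ### Lagrange interpolation at zero from reciprocals of integers -/

section InterpolationNodes

open Finset

/-- The reciprocals of the numbers `⌊D³/k²⌋`, `1 ≤ k ≤ D`, imitate Chebyshev nodes near zero. -/
def node (D k : ℕ) : ℕ := D ^ 3 / k ^ 2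

theorem node_pos {D k : ℕ} (hk : 1 ≤ k) (hkD : k ≤ D) : 0 < node D k := by
  refine Nat.div_pos ?_ (by positivity)
  calc k ^ 2 ≤ D ^ 2 := Nat.pow_le_pow_left hkD 2
    _ ≤ D ^ 3 := Nat.pow_le_pow_right (by omega) (by norm_num)

theorem node_le_cube (D k : ℕ) : node D k ≤ D ^ 3 := Nat.div_le_self _ _

theorem node_le {D k : ℕ} : (node D k : ℝ) ≤ (D : ℝ) ^ 3 / (k : ℝ) ^ 2 := by
  have := @Nat.cast_div_le ℝ _ _ _ (D ^ 3) (k ^ 2)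
  simpa [node] using this

theorem lt_node_add_one {D k : ℕ} (hk : 1 ≤ k) : (D : ℝ) ^ 3 / (k : ℝ) ^ 2 < node D k + 1 := by
  have h : D ^ 3 < (node D k + 1) * k ^ 2 := by
    have := Nat.lt_div_mul_add (a := D ^ 3) (b := k ^ 2) (by positivity)
    unfold node
    linarith
  rw [div_lt_iff₀ (by positivity)]
  exact_mod_cast h

theorem abs_sq_sub_sq_pos {j k : ℕ} (hjk : j ≠ k) : 0 < |(j : ℝ) ^ 2 - (k : ℝ) ^ 2| := by
  rw [abs_pos, sub_ne_zero]
  intro h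
  apply hjk
  have h' : j ^ 2 = k ^ 2 := by exact_mod_cast h
  exact Nat.pow_left_injective (n := 2) (by norm_num) h'

theorem abs_div_sq_sub {D j k : ℕ} (hj : 1 ≤ j) (hk : 1 ≤ k) :
    |(D : ℝ) ^ 3 / (k : ℝ) ^ 2 - (D : ℝ) ^ 3 / (j : ℝ) ^ 2|
      = (D : ℝ) ^ 3 * |(j : ℝ) ^ 2 - (k : ℝ) ^ 2| / ((j : ℝ) ^ 2 * (k : ℝ) ^ 2) := by
  have hj' : (j : ℝ) ≠ 0 := by positivity
  have hk' : (k : ℝ) ≠ 0 := by positivity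
  have : (D : ℝ) ^ 3 / (k : ℝ) ^ 2 - (D : ℝ) ^ 3 / (j : ℝ) ^ 2
      = (D : ℝ) ^ 3 * ((j : ℝ) ^ 2 - (k : ℝ) ^ 2) / ((j : ℝ) ^ 2 * (k : ℝ) ^ 2) := by
    field_simp
  rw [this, abs_div, abs_mul, abs_of_nonneg (by positivity : (0 : ℝ) ≤ (D : ℝ) ^ 3),
    abs_of_nonneg (by positivity : (0 : ℝ) ≤ (j : ℝ) ^ 2 * (k : ℝ) ^ 2)]

/-- With `k ≤ D`, one has `D³(k² - j²) ≥ k³(k + j) ≥ 2j²k²`. A gap of two between the unrounded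
nodes survives rounding, which costs less than one: the nodes stay distinct and each gap loses at
most half its length. -/
theorem two_le_gap_of_lt {D j k : ℕ} (hj : 1 ≤ j) (hjk : j < k) (hkD : k ≤ D) :
    2 ≤ (D : ℝ) ^ 3 * |(j : ℝ) ^ 2 - (k : ℝ) ^ 2| / ((j : ℝ) ^ 2 * (k : ℝ) ^ 2) := by
  have hj0 : (1 : ℝ) ≤ j := by exact_mod_cast hj
  have hjk' : (j : ℝ) + 1 ≤ k := by exact_mod_cast hjk
  have hD : (k : ℝ) ≤ D := by exact_mod_cast hkD
  have hk0 : (0 : ℝ) < k := by linarith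
  rw [le_div_iff₀ (by positivity), abs_sub_comm, abs_of_nonneg (by nlinarith)]
  have h1 : (k : ℝ) ^ 3 ≤ (D : ℝ) ^ 3 := pow_le_pow_left₀ hk0.le hD 3
  have h2 : (k : ℝ) + j ≤ (k : ℝ) ^ 2 - (j : ℝ) ^ 2 := by nlinarith
  calc 2 * ((j : ℝ) ^ 2 * (k : ℝ) ^ 2) ≤ (k : ℝ) ^ 3 * (k + j) := by
        have : 2 * (j : ℝ) ^ 2 ≤ k * (k + j) := by nlinarith
        nlinarith [sq_nonneg (k : ℝ)]
    _ ≤ (D : ℝ) ^ 3 * ((k : ℝ) ^ 2 - (j : ℝ) ^ 2) := by gcongr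

theorem two_le_gap {D j k : ℕ} (hj : 1 ≤ j) (hk : 1 ≤ k) (hjk : j ≠ k) (hjD : j ≤ D)
    (hkD : k ≤ D) :
    2 ≤ (D : ℝ) ^ 3 * |(j : ℝ) ^ 2 - (k : ℝ) ^ 2| / ((j : ℝ) ^ 2 * (k : ℝ) ^ 2) := by
  rcases lt_or_gt_of_ne hjk with h | h
  · exact two_le_gap_of_lt hj h hkD
  · rw [abs_sub_comm, mul_comm ((j : ℝ) ^ 2)]
    exact two_le_gap_of_lt hk h hjD

theorem gap_sub_one_lt {D j k : ℕ} (hj : 1 ≤ j) (hk : 1 ≤ k) :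
    (D : ℝ) ^ 3 * |(j : ℝ) ^ 2 - (k : ℝ) ^ 2| / ((j : ℝ) ^ 2 * (k : ℝ) ^ 2) - 1
      < |(node D k : ℝ) - node D j| := by
  rw [← abs_div_sq_sub hj hk]
  have h1 := @node_le D k
  have h2 := @node_le D j
  have h3 := lt_node_add_one (D := D) hk
  have h4 := lt_node_add_one (D := D) hj
  set a := (D : ℝ) ^ 3 / (k : ℝ) ^ 2
  set b := (D : ℝ) ^ 3 / (j : ℝ) ^ 2
  rcases abs_cases (a - b) with ⟨h, _⟩ | ⟨h, _⟩ <;> rw [h]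
  · have := le_abs_self ((node D k : ℝ) - node D j); linarith
  · have := neg_abs_le ((node D k : ℝ) - node D j); linarith

theorem node_injOn (D : ℕ) : Set.InjOn (node D) (Icc 1 D) := by
  intro j hj k hk h
  by_contra hjk
  simp only [coe_Icc, Set.mem_Icc] at hj hk
  have h1 := two_le_gap hj.1 hk.1 hjk hj.2 hk.2
  have h2 := gap_sub_one_lt (D := D) hj.1 hk.1
  rw [h, sub_self, abs_zero] at h2
  linarith

theorem sq_div_abs_le {j k : ℕ} (hj : 1 ≤ j) (hk : 1 ≤ k) (hjk : j ≠ k) :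
    (j : ℝ) ^ 2 / |(j : ℝ) ^ 2 - (k : ℝ) ^ 2| ≤ 1 + k / |(j : ℝ) - k| := by
  have hj0 : (1 : ℝ) ≤ j := by exact_mod_cast hj
  have hk0 : (1 : ℝ) ≤ k := by exact_mod_cast hk
  have hne : (j : ℝ) - k ≠ 0 := sub_ne_zero.mpr (by exact_mod_cast hjk)
  have hpos : 0 < |(j : ℝ) - k| := abs_pos.mpr hne
  have hfac : |(j : ℝ) ^ 2 - (k : ℝ) ^ 2| = |(j : ℝ) - k| * (j + k) := by
    rw [sq_sub_sq, abs_mul, abs_of_nonneg (by positivity : (0 : ℝ) ≤ j + k), mul_comm]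
  rw [hfac, div_le_iff₀ (by positivity)]
  have : (1 + (k : ℝ) / |(j : ℝ) - k|) * (|(j : ℝ) - k| * (j + k)) = (|(j : ℝ) - k| + k) * (j + k) := by
    field_simp
  rw [this]
  have h := le_abs_self ((j : ℝ) - k)
  nlinarith

/-- The ideal ratio comes from the unrounded nodes. If their gap is `g ≥ 2`, rounding turns `1/g`
into at most `1/(g-1) ≤ (1/g)(1 + 2/g)`. The correction is put into an exponential so that the
product over `j` becomes a sum in the exponent. -/
theorem node_ratio_le {D j k : ℕ} (hj : 1 ≤ j) (hk : 1 ≤ k) (hjk : j ≠ k) (hjD : j ≤ D)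
    (hkD : k ≤ D) :
    (node D k : ℝ) / |(node D k : ℝ) - node D j|
      ≤ (j : ℝ) ^ 2 / |(j : ℝ) ^ 2 - (k : ℝ) ^ 2| *
        Real.exp (2 * ((k : ℝ) ^ 2 / (D : ℝ) ^ 3 * (1 + k / |(j : ℝ) - k|))) := by
  have hD : (0 : ℝ) < D := by exact_mod_cast (by omega : 0 < D)
  have hj0 : (0 : ℝ) < j := by exact_mod_cast hj
  have hk0 : (0 : ℝ) < k := by exact_mod_cast hk
  have hA := abs_sq_sub_sq_pos hjk
  have h1 := two_le_gap hj hk hjk hjD hkD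
  have h2 := gap_sub_one_lt (D := D) hj hk
  have h3 := sq_div_abs_le hj hk hjk
  set A := |(j : ℝ) ^ 2 - (k : ℝ) ^ 2|
  set g := (D : ℝ) ^ 3 * A / ((j : ℝ) ^ 2 * (k : ℝ) ^ 2) with hg
  have hgpos : 0 < g := by positivity
  calc (node D k : ℝ) / |(node D k : ℝ) - node D j|
      ≤ ((D : ℝ) ^ 3 / (k : ℝ) ^ 2) / (g - 1) := by
        apply div_le_div₀ (by positivity) node_le (by linarith) h2.le
    _ ≤ ((D : ℝ) ^ 3 / (k : ℝ) ^ 2) * (1 / g * (1 + 2 * (1 / g))) := by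
        rw [div_eq_mul_inv]
        gcongr
        rw [inv_le_iff_one_le_mul₀ (by linarith)]
        have : 1 / g * (1 + 2 * (1 / g)) * (g - 1) = (1 + 2 * (1 / g)) * (1 - 1 / g) := by
          field_simp
        rw [this]
        have hu : 1 / g ≤ 1 / 2 := one_div_le_one_div_of_le (by norm_num) h1
        have hu0 : 0 < 1 / g := by positivity
        nlinarith
    _ = (j : ℝ) ^ 2 / A * (1 + 2 * (1 / g)) := by
        have : (D : ℝ) ^ 3 / (k : ℝ) ^ 2 * (1 / g) = (j : ℝ) ^ 2 / A := by
          rw [hg]; field_simp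
        rw [← mul_assoc, this]
    _ ≤ (j : ℝ) ^ 2 / A * Real.exp (2 * (1 / g)) := by
        gcongr
        linarith [Real.add_one_le_exp (2 * (1 / g))]
    _ ≤ _ := by
        gcongr
        have : 1 / g = (k : ℝ) ^ 2 / (D : ℝ) ^ 3 * ((j : ℝ) ^ 2 / A) := by
          rw [hg]; field_simp
        rw [this]
        gcongr

/-- The weights at zero of Lagrange interpolation in the points `k²`, `1 ≤ k ≤ D`. -/
theorem prod_sq_div_self (k : ℕ) (hk : 1 ≤ k) :
    ∏ j ∈ (Icc 1 k).erase k, (j : ℝ) ^ 2 / |(j : ℝ) ^ 2 - (k : ℝ) ^ 2|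
      = 2 * (k.factorial : ℝ) ^ 2 / (2 * k).factorial := by
  have hset : (Icc 1 k).erase k = (range (k - 1)).image (· + 1) := by
    ext j; simp only [mem_erase, mem_Icc, mem_image, mem_range]
    constructor
    · rintro ⟨h1, h2, h3⟩; exact ⟨j - 1, by omega, by omega⟩
    · rintro ⟨i, hi, rfl⟩; omega
  obtain ⟨n, rfl⟩ : ∃ n, k = n + 1 := ⟨k - 1, by omega⟩
  rw [hset, prod_image (by intro a _ b _ h; simpa using h), Nat.add_sub_cancel]
  -- A closed form for the partial products makes the induction go through; the full product is `m =
  -- n`.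
  have key : ∀ m, m ≤ n → ∏ i ∈ range m, ((i + 1 : ℕ) : ℝ) ^ 2 /
      |((i + 1 : ℕ) : ℝ) ^ 2 - ((n + 1 : ℕ) : ℝ) ^ 2|
      = (m.factorial : ℝ) ^ 2 * (n - m).factorial * (n + 1) * n.factorial
        / (n.factorial * (n + 1 + m).factorial) := by
    intro m
    induction m with
    | zero =>
      intro _
      have : (n.factorial : ℝ) ≠ 0 := by positivity
      have h1 : ((n : ℝ) + 1) ≠ 0 := by positivity
      simp [Nat.factorial_succ]
      field_simp
    | succ m ih =>
      intro hm
      rw [prod_range_succ, ih (by omega)]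
      obtain ⟨l, rfl⟩ : ∃ l, n = m + 1 + l := ⟨n - (m + 1), by omega⟩
      have e1 : m + 1 + l - m = l + 1 := by omega
      have e2 : m + 1 + l - (m + 1) = l := by omega
      rw [e1, e2]
      have e3 : |((m + 1 : ℕ) : ℝ) ^ 2 - ((m + 1 + l + 1 : ℕ) : ℝ) ^ 2|
          = ((l : ℝ) + 1) * (m + 1 + l + 1 + m + 1) := by
        rw [abs_sub_comm, abs_of_nonneg]
        · push_cast; ring
        · push_cast; nlinarith [(Nat.cast_nonneg m : (0:ℝ) ≤ m), (Nat.cast_nonneg l : (0:ℝ) ≤ l)]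
      rw [e3, show m + 1 + l + 1 + (m + 1) = (m + 1 + l + 1 + m) + 1 by ring,
        Nat.factorial_succ (m + 1 + l + 1 + m), Nat.factorial_succ m, Nat.factorial_succ l]
      have : ((m + 1 + l).factorial : ℝ) ≠ 0 := by positivity
      have : ((m + 1 + l + 1 + m).factorial : ℝ) ≠ 0 := by positivity
      have h1 : ((l : ℝ) + 1) ≠ 0 := by positivity
      have h2 : ((m : ℝ) + 1 + l + 1 + m + 1) ≠ 0 := by positivity
      push_cast
      field_simp
  rw [key n le_rfl, show 2 * (n + 1) = (n + 1 + n) + 1 by ring, Nat.factorial_succ (n + 1 + n),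
    Nat.factorial_succ n]
  have : (n.factorial : ℝ) ≠ 0 := by positivity
  have : ((n + 1 + n).factorial : ℝ) ≠ 0 := by positivity
  have h2 : ((n : ℝ) + 1 + n + 1) ≠ 0 := by positivity
  simp only [Nat.sub_self, Nat.factorial_zero]
  push_cast
  field_simp
  ring

theorem prod_sq_div (k i : ℕ) (hk : 1 ≤ k) :
    ∏ j ∈ (Icc 1 (k + i)).erase k, (j : ℝ) ^ 2 / |(j : ℝ) ^ 2 - (k : ℝ) ^ 2|
      = 2 * ((k + i).factorial : ℝ) ^ 2 / (i.factorial * (2 * k + i).factorial) := by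
  induction i with
  | zero => simpa using prod_sq_div_self k hk
  | succ i ih =>
    have hset : (Icc 1 (k + (i + 1))).erase k = insert (k + i + 1) ((Icc 1 (k + i)).erase k) := by
      ext j; simp only [mem_erase, mem_Icc, mem_insert]; omega
    rw [hset, prod_insert (by simp), ih, show k + (i + 1) = (k + i) + 1 by ring,
      show 2 * k + (i + 1) = (2 * k + i) + 1 by ring, Nat.factorial_succ (k + i),
      Nat.factorial_succ i, Nat.factorial_succ (2 * k + i)]
    have e3 : |((k + i + 1 : ℕ) : ℝ) ^ 2 - (k : ℝ) ^ 2| = ((i : ℝ) + 1) * (2 * k + i + 1) := by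
      rw [abs_of_nonneg]
      · push_cast; ring
      · push_cast; nlinarith [(Nat.cast_nonneg k : (0:ℝ) ≤ k), (Nat.cast_nonneg i : (0:ℝ) ≤ i)]
    rw [e3]
    have : ((2 * k + i).factorial : ℝ) ≠ 0 := by positivity
    have : (i.factorial : ℝ) ≠ 0 := by positivity
    have h1 : ((i : ℝ) + 1) ≠ 0 := by positivity
    have h2 : (2 * (k : ℝ) + i + 1) ≠ 0 := by positivity
    push_cast
    field_simp

/-- The ratio is a product of `k` factors `1 - k/(D+l+1)` with `l < k`, each at most `exp(-k/(2D))`.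
This Gaussian decay of the ideal weights pays for the rounding errors. -/
theorem factorial_ratio_le (D k i : ℕ) (h : D = k + i) (hk : 1 ≤ k) :
    (D.factorial : ℝ) ^ 2 / (i.factorial * (k + D).factorial)
      ≤ Real.exp (-((k : ℝ) ^ 2 / (2 * D))) := by
  have hDpos : (0 : ℝ) < D := by exact_mod_cast (by omega : 0 < D)
  have key : ∀ l, l ≤ k → ((i + l).factorial : ℝ) * D.factorial / (i.factorial * (D + l).factorial)
      ≤ Real.exp (-(l * (k / (2 * D)))) := by
    intro l
    induction l with
    | zero =>
      intro _
      have : (i.factorial : ℝ) ≠ 0 := by positivity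
      have : (D.factorial : ℝ) ≠ 0 := by positivity
      simp
      field_simp
      rfl
    | succ l ih =>
      intro hl
      have e : (((i + (l + 1)).factorial : ℝ) * D.factorial / (i.factorial * (D + (l + 1)).factorial))
          = (((i + l).factorial : ℝ) * D.factorial / (i.factorial * (D + l).factorial))
            * ((i + l + 1) / (D + l + 1)) := by
        rw [show i + (l + 1) = (i + l) + 1 by ring, show D + (l + 1) = (D + l) + 1 by ring,
          Nat.factorial_succ (i + l), Nat.factorial_succ (D + l)]
        have : ((D + l).factorial : ℝ) ≠ 0 := by positivity
        have : (i.factorial : ℝ) ≠ 0 := by positivity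
        push_cast
        field_simp
      rw [e]
      have hstep : ((i : ℝ) + l + 1) / (D + l + 1) ≤ Real.exp (-(k / (2 * D))) := by
        refine le_trans ?_ (Real.add_one_le_exp _)
        have hD : (D : ℝ) = k + i := by exact_mod_cast h
        have hl' : (l : ℝ) + 1 ≤ D := by exact_mod_cast (by omega : l + 1 ≤ D)
        have : ((i : ℝ) + l + 1) / (D + l + 1) = - (k / (D + l + 1)) + 1 := by
          rw [hD]; field_simp; ring
        rw [this]
        gcongr
        linarith
      calc _ ≤ Real.exp (-(l * (k / (2 * D)))) * Real.exp (-(k / (2 * D))) := by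
            gcongr
            exact ih (by omega)
        _ = _ := by rw [← Real.exp_add]; congr 1; push_cast; ring
  have := key k le_rfl
  rw [show i + k = D by omega, show D + k = k + D by ring] at this
  calc _ = (D.factorial : ℝ) * D.factorial / (i.factorial * (k + D).factorial) := by rw [sq]
    _ ≤ _ := this
    _ = _ := by congr 1; ring

/-- Terms outside the nine indices around `k` are at most `1/4`. The slope `1/4` is chosen so that
the resulting error `k²/(2D)` in `prod_node_ratio_le` is exactly the Gaussian exponent available; no
logarithm appears. -/
theorem sum_inv_dist_le (D k : ℕ) :
    ∑ j ∈ (Icc 1 D).erase k, 1 / |(j : ℝ) - k| ≤ D / 4 + 9 := by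
  have hpt : ∀ j ∈ (Icc 1 D).erase k, 1 / |(j : ℝ) - k|
      ≤ 1 / 4 + if j ∈ Icc (k - 4) (k + 4) then (1 : ℝ) else 0 := by
    intro j hj
    simp only [mem_erase] at hj
    have hne : 1 ≤ |(j : ℤ) - k| := Int.one_le_abs (by omega)
    have hne' : (1 : ℝ) ≤ |(j : ℝ) - k| := by exact_mod_cast hne
    split_ifs with hmem
    · have : 1 / |(j : ℝ) - k| ≤ 1 := by
        rw [div_le_one (by linarith)]; exact hne'
      linarith
    · have h4 : 4 ≤ |(j : ℤ) - k| := by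
        simp only [mem_Icc, not_and_or, not_le] at hmem
        rcases hmem with h | h
        · rw [abs_sub_comm]; exact le_trans (by omega) (le_abs_self _)
        · exact le_trans (by omega) (le_abs_self _)
      have h4' : (4 : ℝ) ≤ |(j : ℝ) - k| := by exact_mod_cast h4
      rw [add_zero]
      exact one_div_le_one_div_of_le (by norm_num) h4'
  refine (sum_le_sum hpt).trans ?_
  rw [sum_add_distrib, sum_const, ← sum_filter, sum_const, nsmul_eq_mul, nsmul_eq_mul, mul_one]
  have c1 : ((Icc 1 D).erase k).card ≤ D := (card_le_card (erase_subset _ _)).trans (by simp)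
  have c2 : (((Icc 1 D).erase k).filter (· ∈ Icc (k - 4) (k + 4))).card ≤ 9 := by
    refine (card_le_card (t := Icc (k - 4) (k + 4)) ?_).trans ?_
    · intro x hx; exact (mem_filter.mp hx).2
    · simp; omega
  have c1' : ((((Icc 1 D).erase k).card : ℕ) : ℝ) ≤ D := by exact_mod_cast c1
  have c2' : (((((Icc 1 D).erase k).filter (· ∈ Icc (k - 4) (k + 4))).card : ℕ) : ℝ) ≤ 9 := by
    exact_mod_cast c2
  linarith

theorem prod_node_ratio_le {D k : ℕ} (hk : 1 ≤ k) (hkD : k ≤ D) :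
    ∏ j ∈ (Icc 1 D).erase k, (node D k : ℝ) / |(node D k : ℝ) - node D j| ≤ 2 * Real.exp 20 := by
  have hD : (1 : ℝ) ≤ D := by exact_mod_cast hk.trans hkD
  have hk0 : (1 : ℝ) ≤ k := by exact_mod_cast hk
  have hkD' : (k : ℝ) ≤ D := by exact_mod_cast hkD
  obtain ⟨i, hi⟩ : ∃ i, D = k + i := ⟨D - k, by omega⟩
  calc ∏ j ∈ (Icc 1 D).erase k, (node D k : ℝ) / |(node D k : ℝ) - node D j|
      ≤ ∏ j ∈ (Icc 1 D).erase k, ((j : ℝ) ^ 2 / |(j : ℝ) ^ 2 - (k : ℝ) ^ 2| *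
        Real.exp (2 * ((k : ℝ) ^ 2 / (D : ℝ) ^ 3 * (1 + k / |(j : ℝ) - k|)))) := by
        refine prod_le_prod (fun j _ => by positivity) fun j hj => ?_
        simp only [mem_erase, mem_Icc] at hj
        exact node_ratio_le hj.2.1 hk hj.1 hj.2.2 hkD
    _ = 2 * ((D.factorial : ℝ) ^ 2 / (i.factorial * (k + D).factorial)) *
        Real.exp (∑ j ∈ (Icc 1 D).erase k,
          2 * ((k : ℝ) ^ 2 / (D : ℝ) ^ 3 * (1 + k / |(j : ℝ) - k|))) := by
        rw [prod_mul_distrib, ← Real.exp_sum]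
        congr 1
        rw [hi, prod_sq_div k i hk, show k + (k + i) = 2 * k + i by ring, mul_div_assoc]
    -- The rounding exponent is at most `2(k²/D³)(D + D(D/4 + 9)) = 20k²/D² + k²/(2D)`; its last
    -- term cancels the Gaussian decay.
    _ ≤ 2 * Real.exp (-((k : ℝ) ^ 2 / (2 * D))) * Real.exp (20 + (k : ℝ) ^ 2 / (2 * D)) := by
        gcongr
        · exact factorial_ratio_le D k i hi hk
        · rw [← mul_sum, ← mul_sum, sum_add_distrib, sum_const, nsmul_eq_mul, mul_one]
          have e : ∑ j ∈ (Icc 1 D).erase k, (k : ℝ) / |(j : ℝ) - k|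
              = k * ∑ j ∈ (Icc 1 D).erase k, 1 / |(j : ℝ) - k| := by
            rw [mul_sum]; exact sum_congr rfl fun j _ => by ring
          have c1 : ((((Icc 1 D).erase k).card : ℕ) : ℝ) ≤ D := by
            exact_mod_cast (card_le_card (erase_subset _ _)).trans (by simp)
          have hs := sum_inv_dist_le D k
          rw [e]
          calc 2 * ((k : ℝ) ^ 2 / (D : ℝ) ^ 3 * ((((Icc 1 D).erase k).card : ℕ) +
                  k * ∑ j ∈ (Icc 1 D).erase k, 1 / |(j : ℝ) - k|))
              ≤ 2 * ((k : ℝ) ^ 2 / (D : ℝ) ^ 3 * (D + D * (D / 4 + 9))) := by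
                gcongr
            _ = 20 * ((k : ℝ) ^ 2 / (D : ℝ) ^ 2) + (k : ℝ) ^ 2 / (2 * D) := by
                field_simp; ring
            _ ≤ 20 + (k : ℝ) ^ 2 / (2 * D) := by
                have : (k : ℝ) ^ 2 / (D : ℝ) ^ 2 ≤ 1 := by
                  rw [div_le_one (by positivity)]; gcongr
                linarith
    _ = 2 * Real.exp 20 := by
        rw [mul_assoc, ← Real.exp_add]; congr 2; ring

theorem sum_one_div_sq_le (D : ℕ) : ∑ k ∈ Icc 1 D, 1 / (k : ℝ) ^ 2 ≤ 2 := by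
  have key : ∀ n : ℕ, ∑ k ∈ Icc 1 (n + 1), 1 / (k : ℝ) ^ 2 ≤ 2 - 1 / ((n : ℝ) + 1) := by
    intro n
    induction n with
    | zero => norm_num
    | succ n ih =>
      rw [sum_Icc_succ_top (by omega)]
      have : 1 / ((n + 1 + 1 : ℕ) : ℝ) ^ 2 ≤ 1 / ((n : ℝ) + 1) - 1 / ((n : ℝ) + 1 + 1) := by
        push_cast
        rw [div_sub_div _ _ (by positivity) (by positivity),
          div_le_div_iff₀ (by positivity) (by positivity)]
        nlinarith [(Nat.cast_nonneg n : (0:ℝ) ≤ n)]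
      push_cast at *
      linarith
  rcases D with _ | n
  · simp
  · exact (key n).trans (by linarith [show (0:ℝ) ≤ 1 / ((n:ℝ) + 1) by positivity])

/-- The Lagrange weights at zero for the nodes `1 / node D k`. -/
noncomputable def nodeWeight (D k : ℕ) : ℂ :=
  ((Lagrange.basis (Icc 1 D) (fun k => ((node D k : ℂ))⁻¹) k).eval 0)

/-- For nodes `1/n_k` the Lagrange factor at zero is `n_k/(n_k - n_j)`, so the bound is that on the
product of node ratios. -/
theorem norm_nodeWeight_le {D k : ℕ} (hk : 1 ≤ k) (hkD : k ≤ D) :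
    ‖nodeWeight D k‖ ≤ 2 * Real.exp 20 := by
  refine le_trans (le_of_eq ?_) (prod_node_ratio_le hk hkD)
  rw [nodeWeight, Lagrange.basis, Polynomial.eval_prod, norm_prod]
  refine prod_congr rfl fun j hj => ?_
  simp only [mem_erase, mem_Icc] at hj
  have hne : node D k ≠ node D j := fun h =>
    hj.1 (node_injOn D (by simp [hj]) (by simp [hk, hkD]) h.symm)
  have hk' : (node D k : ℂ) ≠ 0 := by exact_mod_cast (node_pos hk hkD).ne'
  have hj' : (node D j : ℂ) ≠ 0 := by exact_mod_cast (node_pos hj.2.1 hj.2.2).ne'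
  have hne' : (node D k : ℂ) - node D j ≠ 0 := sub_ne_zero.mpr (by exact_mod_cast hne)
  have hne2 : (node D j : ℂ) - node D k ≠ 0 := sub_ne_zero.mpr (by exact_mod_cast hne.symm)
  rw [Lagrange.basisDivisor]
  simp only [Polynomial.eval_mul, Polynomial.eval_C, Polynomial.eval_sub, Polynomial.eval_X]
  have e : ((node D k : ℂ)⁻¹ - (node D j : ℂ)⁻¹)⁻¹ * (0 - (node D j : ℂ)⁻¹)
      = (node D k : ℂ) / ((node D k : ℂ) - node D j) := by
    rw [inv_sub_inv hk' hj']
    field_simp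
    ring
  rw [e, norm_div, Complex.norm_natCast]
  congr 1
  rw [← Complex.ofReal_natCast, ← Complex.ofReal_natCast, ← Complex.ofReal_sub, Complex.norm_real,
    Real.norm_eq_abs]

theorem eval_zero_eq_sum_nodeWeight {D : ℕ} (p : Polynomial ℂ) (hp : p.degree < D) :
    p.eval 0 = ∑ k ∈ Icc 1 D, nodeWeight D k * p.eval (node D k : ℂ)⁻¹ := by
  have hinj : Set.InjOn (fun k => ((node D k : ℂ))⁻¹) (Icc 1 D : Finset ℕ) := by
    intro a ha b hb h
    exact node_injOn D ha hb (by simpa using h)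
  have h := Lagrange.eq_interpolate (f := p) hinj (by simpa using hp)
  rw [Lagrange.interpolate_apply] at h
  conv_lhs => rw [h]
  rw [Polynomial.eval_finsetSum]
  refine sum_congr rfl fun k _ => ?_
  rw [Polynomial.eval_mul, Polynomial.eval_C, nodeWeight, mul_comm]

/-- The weights are bounded and the nodes are at most `D³/k²`, whose sum over `k` converges. -/
theorem sum_norm_nodeWeight_mul_le (D : ℕ) :
    ∑ k ∈ Icc 1 D, ‖nodeWeight D k‖ * node D k ≤ 4 * Real.exp 20 * (D : ℝ) ^ 3 := by
  calc ∑ k ∈ Icc 1 D, ‖nodeWeight D k‖ * node D k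
      ≤ ∑ k ∈ Icc 1 D, 2 * Real.exp 20 * ((D : ℝ) ^ 3 * (1 / (k : ℝ) ^ 2)) := by
        refine sum_le_sum fun k hk => ?_
        rw [mem_Icc] at hk
        have := @node_le D k
        rw [mul_one_div]
        gcongr
        exact norm_nodeWeight_le hk.1 hk.2
    _ = 2 * Real.exp 20 * (D : ℝ) ^ 3 * ∑ k ∈ Icc 1 D, 1 / (k : ℝ) ^ 2 := by
        rw [mul_sum]; exact sum_congr rfl fun k _ => by ring
    _ ≤ 2 * Real.exp 20 * (D : ℝ) ^ 3 * 2 := by gcongr; exact sum_one_div_sq_le D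
    _ = _ := by ring

end InterpolationNodes

/-! ### Means over identified samples as polynomials in the reciprocal number of colours -/

section Juntas

open Finset

theorem measurePreserving_comp_of_injective {α β X : Type*} [Fintype α] [Fintype β]
    [MeasurableSpace X] (D : Measure X) [IsProbabilityMeasure D] {e : α → β}
    (he : Function.Injective e) :
    MeasurePreserving (fun w : β → X => w ∘ e) (Measure.pi fun _ => D) (Measure.pi fun _ => D) := by
  have hm : Measurable (fun w : β → X => w ∘ e) :=
    measurable_pi_lambda _ fun a => measurable_pi_apply (e a)
  refine ⟨hm, (Measure.pi_eq fun s hs => ?_).symm⟩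
  rw [Measure.map_apply hm (MeasurableSet.univ_pi hs)]
  have hpre : (fun w : β → X => w ∘ e) ⁻¹' Set.univ.pi s
      = Set.univ.pi (Function.extend e s fun _ => Set.univ) := by
    ext w
    simp only [Set.mem_preimage, Set.mem_univ_pi, Function.comp_apply]
    constructor
    · intro h b
      by_cases hb : ∃ a, e a = b
      · obtain ⟨a, rfl⟩ := hb
        rw [he.extend_apply]; exact h a
      · rw [Function.extend_apply' _ _ _ hb]; trivial
    · intro h a
      have := h (e a)
      rwa [he.extend_apply] at this
  rw [hpre, Measure.pi_pi]
  refine (Fintype.prod_of_injective e he _ _ ?_ ?_).symm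
  · intro b hb
    rw [Function.extend_apply' _ _ _ (by simpa using hb), measure_univ]
  · intro a
    rw [he.extend_apply]

/-- Writes the number of injections from `l` points into `r` as `r^l` times a polynomial in `1/r`.
For `l > r` both sides vanish, so no restriction on `r` is needed beyond `r ≠ 0`. -/
theorem cast_descFactorial_eq (r l : ℕ) (hr : r ≠ 0) :
    (r.descFactorial l : ℂ) = (r : ℂ) ^ l * ∏ a ∈ range l, (1 - (a : ℂ) * (r : ℂ)⁻¹) := by
  have hr' : (r : ℂ) ≠ 0 := by exact_mod_cast hr
  induction l with
  | zero => simp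
  | succ l ih =>
    rw [Nat.descFactorial_succ, prod_range_succ, Nat.cast_mul, ih]
    rcases le_or_gt l r with h | h
    · rw [Nat.cast_sub h, pow_succ]
      linear_combination (r : ℂ) ^ l * l *
        (∏ a ∈ range l, (1 - (a : ℂ) * (r : ℂ)⁻¹)) * mul_inv_cancel₀ hr'
    · have h0 : (r.descFactorial l : ℂ) = 0 := by
        exact_mod_cast Nat.descFactorial_of_lt h
      rw [ih] at h0
      rw [h0, mul_zero, pow_succ]
      linear_combination (-(r : ℂ) * (1 - l * (r : ℂ)⁻¹)) * h0

/-- Functions with a prescribed kernel are the injections on the quotient. -/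
def kerEqEquivEmbedding {κ β : Type*} (s : Setoid κ) :
    {f : κ → β // Setoid.ker f = s} ≃ (Quotient s ↪ β) where
  toFun f := ⟨Quotient.lift f.1 fun a b hab => by
      have : (Setoid.ker f.1) a b := by rw [f.2]; exact hab
      exact this, by
    intro a b
    induction a using Quotient.inductionOn
    induction b using Quotient.inductionOn
    rename_i a b
    intro h
    have h' : (Setoid.ker f.1) a b := h
    rw [f.2] at h'
    exact Quotient.sound h'⟩
  invFun e := ⟨fun a => e (Quotient.mk s a), by
    ext a b
    constructor
    · intro h
      exact Quotient.exact (e.injective h)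
    · intro h
      exact congrArg e (Quotient.sound h)⟩
  left_inv f := by ext; rfl
  right_inv e := by
    ext a
    induction a using Quotient.inductionOn
    rfl

variable {X : Type*} [TopologicalSpace X] [SecondCountableTopology X]
  [MeasurableSpace X] [BorelSpace X]

theorem integral_comp_injective (D : Measure X) [IsProbabilityMeasure D] {α β : Type*} [Fintype α]
    [Fintype β] {e : α → β} (he : Function.Injective e) {h : (α → X) → ℂ} (hc : Continuous h) :
    ∫ w : β → X, h (w ∘ e) ∂(Measure.pi fun _ => D) = ∫ v, h v ∂(Measure.pi fun _ => D) := by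
  have hp := measurePreserving_comp_of_injective D he
  rw [← hp.map_eq, integral_map hp.measurable.aemeasurable
    hc.measurable.aestronglyMeasurable]

/-- The average over all maps to `r` colours of the mean of a function of i.i.d. samples, where the
samples with equal colours are identified. -/
noncomputable def identifiedMean {ι : Type*} [Fintype ι] [DecidableEq ι] (D : Measure X) (r : ℕ)
    (g : (ι → X) → ℂ) : ℂ :=
  ((r : ℂ) ^ Fintype.card ι)⁻¹ *
    ∑ f : ι → Fin r, ∫ w : Fin r → X, g (w ∘ f) ∂(Measure.pi fun _ => D)

/-- Group the colourings by their kernel, a partition into `l` classes. The integral depends only on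
the partition, since distinct colours carry independent samples, and `r(r-1)⋯(r-l+1)` colourings
have this kernel. Division by `r^|κ|` leaves `u^(|κ|-l) ∏_{a<l} (1 - a u)` with `u = 1/r`. At `u =
0` only the discrete partition survives, which is the independent case. -/
theorem exists_polynomial_identifiedMean {κ : Type*} [Fintype κ] [DecidableEq κ] (D : Measure X)
    [IsProbabilityMeasure D] {h : (κ → X) → ℂ} (hc : Continuous h) :
    ∃ p : Polynomial ℂ, p.natDegree ≤ Fintype.card κ - 1 ∧
      p.eval 0 = ∫ v, h v ∂(Measure.pi fun _ => D) ∧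
      ∀ r : ℕ, r ≠ 0 → p.eval (r : ℂ)⁻¹ = identifiedMean D r h := by
  classical
  have : Finite (Setoid κ) := Finite.of_injective (fun s : Setoid κ => s.r) fun s t hst =>
    Setoid.ext fun a b => by
      have := congrFun (congrFun hst a) b
      exact Iff.of_eq this
  have : Fintype (Setoid κ) := Fintype.ofFinite _
  have hfq : ∀ s : Setoid κ, Finite (Quotient s) := fun s => inferInstance
  let hFq : ∀ s : Setoid κ, Fintype (Quotient s) := fun s => Fintype.ofFinite _
  let c : Setoid κ → ℂ := fun s =>
    ∫ v : Quotient s → X, h (v ∘ Quotient.mk s) ∂(Measure.pi fun _ => D)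
  let l : Setoid κ → ℕ := fun s => Fintype.card (Quotient s)
  have hl : ∀ s, l s ≤ Fintype.card κ := fun s =>
    Fintype.card_le_of_surjective (Quotient.mk s) Quotient.mk_surjective
  refine ⟨∑ s, Polynomial.C (c s) * (Polynomial.X ^ (Fintype.card κ - l s) *
    ∏ a ∈ range (l s), (1 - Polynomial.C (a : ℂ) * Polynomial.X)), ?_, ?_, ?_⟩
  · refine Polynomial.natDegree_sum_le_of_forall_le _ _ fun s _ => ?_
    refine (Polynomial.natDegree_C_mul_le _ _).trans ?_
    refine Polynomial.natDegree_mul_le.trans ?_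
    have hprod : (∏ a ∈ range (l s), (1 - Polynomial.C (a : ℂ) * Polynomial.X)).natDegree
        ≤ l s - 1 := by
      rcases hls : l s with _ | n
      · simp
      -- The factor with `a = 0` is `1`. This saves one degree, so `n` nodes suffice for functions
      -- of `n` coordinates.
      · rw [prod_range_succ']
        simp only [Nat.cast_zero, map_zero, zero_mul, sub_zero, mul_one, Nat.add_sub_cancel]
        refine (Polynomial.natDegree_prod_le _ _).trans ?_
        refine (sum_le_card_nsmul _ _ 1 fun a _ => ?_).trans (by simp)
        refine (Polynomial.natDegree_sub_le _ _).trans ?_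
        rw [Polynomial.natDegree_one]
        exact max_le (by norm_num)
          ((Polynomial.natDegree_C_mul_le _ _).trans Polynomial.natDegree_X_le)
    have h1 : (Polynomial.X ^ (Fintype.card κ - l s) : Polynomial ℂ).natDegree
        ≤ Fintype.card κ - l s := by simp
    have h0 : l s = 0 → Fintype.card κ = 0 := by
      intro h
      rw [Fintype.card_eq_zero_iff] at h ⊢
      exact ⟨fun a => h.elim (Quotient.mk s a)⟩
    have := hl s
    omega
  · rw [Polynomial.eval_finsetSum, sum_eq_single (⊥ : Setoid κ)]
    · have hinj : Function.Injective (Quotient.mk (⊥ : Setoid κ)) := fun a b hab =>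
        Quotient.exact hab
      have hcard : l ⊥ = Fintype.card κ :=
        (Fintype.card_of_bijective ⟨hinj, Quotient.mk_surjective⟩).symm
      have hcb : c ⊥ = ∫ v, h v ∂(Measure.pi fun _ => D) := integral_comp_injective D hinj hc
      simp [Polynomial.eval_prod, hcard, hcb]
    · intro s _ hs
      have hlt : l s < Fintype.card κ := by
        refine lt_of_le_of_ne (hl s) fun heq => hs ?_
        have hbij := (Fintype.bijective_iff_surjective_and_card (Quotient.mk s)).mpr
          ⟨Quotient.mk_surjective, heq.symm⟩
        ext a b
        constructor
        · intro hab
          exact hbij.1 (Quotient.sound hab)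
        · rintro rfl
          exact s.refl _
      simp [zero_pow (Nat.sub_ne_zero_of_lt hlt)]
    · simp
  · intro r hr
    have hr' : (r : ℂ) ≠ 0 := by exact_mod_cast hr
    have key : ∀ f : κ → Fin r, ∫ w : Fin r → X, h (w ∘ f) ∂(Measure.pi fun _ => D)
        = c (Setoid.ker f) := by
      intro f
      have he := Setoid.kerLift_injective f
      rw [show (fun w : Fin r → X => h (w ∘ f))
        = fun w => (fun v => h (v ∘ Quotient.mk (Setoid.ker f))) (w ∘ Setoid.kerLift f) from rfl]
      exact integral_comp_injective D he (h := fun v => h (v ∘ Quotient.mk (Setoid.ker f)))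
        (hc.comp (continuous_pi fun i => continuous_apply _))
    have hcount : ∀ s : Setoid κ, (#{f : κ → Fin r | Setoid.ker f = s} : ℕ)
        = r.descFactorial (l s) := by
      intro s
      rw [← Fintype.card_subtype, Fintype.card_congr (kerEqEquivEmbedding s),
        Fintype.card_embedding_eq, Fintype.card_fin]
    rw [identifiedMean, sum_congr rfl fun f _ => key f,
      ← sum_fiberwise_of_maps_to (t := univ) (g := fun f : κ → Fin r => Setoid.ker f)
        (fun _ _ => mem_univ _), Polynomial.eval_finsetSum, mul_sum]
    refine sum_congr rfl fun s _ => ?_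
    rw [sum_congr rfl (g := fun _ => c s) (fun f hf => by rw [(mem_filter.mp hf).2]), sum_const,
      nsmul_eq_mul, hcount, cast_descFactorial_eq r _ hr]
    simp only [Polynomial.eval_mul, Polynomial.eval_C, Polynomial.eval_pow, Polynomial.eval_X,
      Polynomial.eval_prod, Polynomial.eval_sub, Polynomial.eval_one]
    have : (r : ℂ) ^ Fintype.card κ = (r : ℂ) ^ (Fintype.card κ - l s) * (r : ℂ) ^ l s := by
      rw [← pow_add, Nat.sub_add_cancel (hl s)]
    rw [this, inv_pow]
    field_simp

theorem sum_comp_restrict {ι : Type*} [Fintype ι] [DecidableEq ι] (T : Finset ι) {r : ℕ}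
    (F : (T → Fin r) → ℂ) :
    ∑ f : ι → Fin r, F (fun i => f i) = (r : ℂ) ^ (Fintype.card ι - #T) * ∑ f, F f := by
  rw [← (Equiv.piEquivPiSubtypeProd (· ∈ T) fun _ => Fin r).symm.sum_comp, Fintype.sum_prod_type,
    mul_sum]
  refine sum_congr rfl fun f _ => ?_
  have : ∀ g : ({i // i ∉ T} → Fin r),
      (fun i : T => (Equiv.piEquivPiSubtypeProd (· ∈ T) fun _ => Fin r).symm (f, g) i) = f := by
    intro g
    funext i
    simp [Equiv.piEquivPiSubtypeProd]
  simp only [this, sum_const, card_univ, Fintype.card_fun, Fintype.card_fin, nsmul_eq_mul]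
  congr 2
  push_cast
  rw [Fintype.card_subtype_compl, Fintype.card_coe]

end Juntas

/-! ### Functions of few coordinates -/

section Juntas

open Finset

/-- Linear combinations of continuous functions of at most `k` of the coordinates. -/
def junta (X ι : Type*) [TopologicalSpace X] (k : ℕ) : Submodule ℂ ((ι → X) → ℂ) :=
  Submodule.span ℂ {g | ∃ T : Finset ι, #T ≤ k ∧ ∃ h : (T → X) → ℂ, Continuous h ∧
    g = fun z => h fun i => z i}

variable {X : Type*} [TopologicalSpace X] {ι : Type*}

theorem junta_mono {a b : ℕ} (hab : a ≤ b) : junta X ι a ≤ junta X ι b :=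
  Submodule.span_mono fun _ ⟨T, hT, hh⟩ => ⟨T, hT.trans hab, hh⟩

theorem continuous_of_mem_junta {k : ℕ} {g : (ι → X) → ℂ} (hg : g ∈ junta X ι k) :
    Continuous g := by
  induction hg using Submodule.span_induction with
  | mem g hg =>
    obtain ⟨T, _, h, hc, rfl⟩ := hg
    exact hc.comp (by fun_prop)
  | zero => exact continuous_zero
  | add g g' _ _ h h' => exact h.add h'
  | smul c g _ h => exact h.const_smul c

theorem star_mem_junta {k : ℕ} {g : (ι → X) → ℂ} (hg : g ∈ junta X ι k) :
    star g ∈ junta X ι k := by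
  induction hg using Submodule.span_induction with
  | mem g hg =>
    obtain ⟨T, hT, h, hc, rfl⟩ := hg
    exact Submodule.subset_span ⟨T, hT, star h, hc.star, rfl⟩
  | zero => rw [star_zero]; exact zero_mem _
  | add g g' _ _ h h' => rw [star_add]; exact add_mem h h'
  | smul c g _ h => rw [star_smul]; exact Submodule.smul_mem _ _ h

theorem mul_mem_junta {a b : ℕ} {g g' : (ι → X) → ℂ} (hg : g ∈ junta X ι a)
    (hg' : g' ∈ junta X ι b) : g * g' ∈ junta X ι (a + b) := by
  classical
  have hle : junta X ι a * junta X ι b ≤ junta X ι (a + b) := by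
    rw [junta, junta, Submodule.span_mul_span, Submodule.span_le]
    rintro _ ⟨_, ⟨T, hT, h, hc, rfl⟩, _, ⟨T', hT', h', hc', rfl⟩, rfl⟩
    refine Submodule.subset_span ⟨T ∪ T', (card_union_le _ _).trans (add_le_add hT hT'),
      fun z => h (fun i => z ⟨i, mem_union_left _ i.2⟩) *
        h' (fun i => z ⟨i, mem_union_right _ i.2⟩), ?_, rfl⟩
    exact (hc.comp (by fun_prop)).mul (hc'.comp (by fun_prop))
  exact hle (Submodule.mul_mem_mul hg hg')

theorem const_mem_junta (c : ℂ) : (fun _ => c) ∈ junta X ι 0 :=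
  Submodule.subset_span ⟨∅, by simp, fun _ => c, continuous_const, rfl⟩

theorem apply_mem_junta {h : X → ℂ} (hc : Continuous h) (i : ι) :
    (fun z : ι → X => h (z i)) ∈ junta X ι 1 :=
  Submodule.subset_span ⟨{i}, by simp, fun z => h (z ⟨i, by simp⟩), hc.comp (by fun_prop), rfl⟩

variable [SecondCountableTopology X] [MeasurableSpace X] [BorelSpace X] [CompactSpace X] [T2Space X]
  [Fintype ι]
  [DecidableEq ι]

theorem integrable_of_continuous_pi {κ : Type*} [Fintype κ] (D : Measure X)
    [IsProbabilityMeasure D] {h : (κ → X) → ℂ} (hc : Continuous h) :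
    Integrable h (Measure.pi fun _ => D) := by
  have := hc.continuousOn.integrableOn_compact (μ := Measure.pi fun _ : κ => D)
    (isCompact_univ (X := κ → X))
  rwa [integrableOn_univ] at this

/-- The true mean of a function of few coordinates is a fixed combination of means over samples with
identifications. -/
theorem integral_eq_sum_identifiedMean (D : Measure X) [IsProbabilityMeasure D] {k n : ℕ}
    (hn : 1 ≤ n) (hkn : k ≤ n) {g : (ι → X) → ℂ} (hg : g ∈ junta X ι k) :
    ∫ z, g z ∂(Measure.pi fun _ => D)
      = ∑ j ∈ Icc 1 n, nodeWeight n j * identifiedMean D (node n j) g := by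
  have hi : ∀ {r : ℕ} (f : ι → Fin r) {g : (ι → X) → ℂ}, Continuous g →
      Integrable (fun w : Fin r → X => g (w ∘ f)) (Measure.pi fun _ => D) := fun f g hc =>
    integrable_of_continuous_pi D (hc.comp (continuous_pi fun i => continuous_apply _))
  -- Nodes and weights do not depend on `g`, so both sides are linear in `g` and a function of the
  -- coordinates in one small set `T` suffices; colours outside `T` average out.
  induction hg using Submodule.span_induction with
  | mem g hg =>
    obtain ⟨T, hT, h, hc, rfl⟩ := hg
    obtain ⟨p, hdeg, h0, hr⟩ := exists_polynomial_identifiedMean D hc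
    -- For `T = ∅` the truncated `#T - 1` is `0`, and the inequality needs `1 ≤ n`.
    have hlt : p.degree < n := by
      refine (Polynomial.degree_le_of_natDegree_le hdeg).trans_lt ?_
      rw [Fintype.card_coe]
      exact_mod_cast (by omega : #T - 1 < n)
    have e0 : ∫ z : ι → X, h (fun i => z i) ∂(Measure.pi fun _ => D) = p.eval 0 := by
      rw [h0]
      exact integral_comp_injective D (e := fun i : T => (i : ι)) Subtype.val_injective hc
    rw [e0, eval_zero_eq_sum_nodeWeight p hlt]
    refine sum_congr rfl fun j hj => ?_
    rw [mem_Icc] at hj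
    have hpos := node_pos hj.1 hj.2
    have hpos' : (node n j : ℂ) ≠ 0 := by exact_mod_cast hpos.ne'
    rw [hr _ hpos.ne', identifiedMean, identifiedMean]
    congr 1
    have := sum_comp_restrict T (fun f : T → Fin (node n j) =>
      ∫ w : Fin (node n j) → X, h (w ∘ f) ∂(Measure.pi fun _ => D))
    rw [show (fun f : ι → Fin (node n j) => ∫ w : Fin (node n j) → X,
        (fun z : ι → X => h fun i : T => z i) (w ∘ f) ∂(Measure.pi fun _ => D))
      = fun f => (fun f : T → Fin (node n j) =>
      ∫ w : Fin (node n j) → X, h (w ∘ f) ∂(Measure.pi fun _ => D)) (fun i => f i) from rfl, this,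
      ← mul_assoc, Fintype.card_coe]
    congr 1
    have hsplit : (node n j : ℂ) ^ Fintype.card ι
        = (node n j : ℂ) ^ (Fintype.card ι - #T) * (node n j : ℂ) ^ #T := by
      rw [← pow_add, Nat.sub_add_cancel (card_le_univ T)]
    rw [hsplit]
    field_simp
  | zero => simp [identifiedMean]
  | add g g' hg hg' h h' =>
    have hc := continuous_of_mem_junta hg
    have hc' := continuous_of_mem_junta hg'
    have e : ∀ r, identifiedMean D r (g + g') = identifiedMean D r g + identifiedMean D r g' := by
      intro r
      simp only [identifiedMean, Pi.add_apply]
      rw [← mul_add, ← sum_add_distrib]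
      congr 1
      exact sum_congr rfl fun f _ => integral_add (hi f hc) (hi f hc')
    simp only [Pi.add_apply, e, mul_add, sum_add_distrib]
    rw [← h, ← h']
    exact integral_add (integrable_of_continuous_pi D hc) (integrable_of_continuous_pi D hc')
  | smul c g hg h =>
    have e : ∀ r, identifiedMean D r (c • g) = c * identifiedMean D r g := by
      intro r
      simp only [identifiedMean, Pi.smul_apply, smul_eq_mul, integral_const_mul, ← mul_sum]
      ring
    simp only [Pi.smul_apply, smul_eq_mul, integral_const_mul, e, h, mul_sum]
    exact sum_congr rfl fun j _ => by ring

end Juntas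

namespace BlackBoxMoney

/-! ### Weights of a state along triples of columns -/

section Weights

open Finset

variable {N r m : ℕ}

theorem orthogonal_sum_mul_row (O : Matrix.orthogonalGroup (Fin N) ℝ) (k l : Fin N) :
    ∑ i, O.1 k i * O.1 l i = if k = l then 1 else 0 := by
  have h := (Matrix.mem_unitaryGroup_iff).mp O.2
  have := congrFun (congrFun h k) l
  simpa [Matrix.mul_apply, Matrix.star_apply, Matrix.one_apply] using this

theorem orthogonal_sum_mul_col (O : Matrix.orthogonalGroup (Fin N) ℝ) (i j : Fin N) :
    ∑ k, O.1 k i * O.1 k j = if i = j then 1 else 0 := by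
  have h := (Matrix.mem_unitaryGroup_iff').mp O.2
  have := congrFun (congrFun h i) j
  simpa [Matrix.mul_apply, Matrix.star_apply, Matrix.one_apply] using this

theorem sum_prod_fin_three {N : ℕ} (F : Fin 3 → Fin N → ℝ) :
    ∑ a : Fin 3 → Fin N, ∏ s, F s (a s) = ∏ s, ∑ i, F s i := by
  rw [prod_univ_sum, Fintype.piFinset_univ]

/-- The component of a state along three columns of an orthogonal matrix in the output registers
and a computational basis state of the remaining registers. -/
noncomputable def coeff (O : Matrix (Fin N) (Fin N) ℝ) (Φ : State N r m) (a : Fin 3 → Fin N)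
    (y : (Fin r → Fin N) × (Fin m → Bool)) : ℂ :=
  ∑ x : Fin 3 → Fin N, ((∏ s, O (x s) (a s) : ℝ) : ℂ) * Φ (Sum.elim x y.1, y.2)

/-- The squared norm of the part of a state in which the output registers hold three copies of one
column. -/
noncomputable def tripleWeight (O : Matrix (Fin N) (Fin N) ℝ) (Φ : State N r m) : ℝ :=
  ∑ i, ∑ y, ‖coeff O Φ (fun _ => i) y‖ ^ 2

theorem sum_config {M : Type*} [AddCommMonoid M] (F : Config N r m → M) :
    ∑ x, F x = ∑ y : (Fin r → Fin N) × (Fin m → Bool), ∑ x : Fin 3 → Fin N,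
      F (Sum.elim x y.1, y.2) := by
  rw [Fintype.sum_prod_type, Fintype.sum_prod_type,
    ← (Equiv.sumArrowEquivProdArrow (Fin 3) (Fin r) (Fin N)).symm.sum_comp, Fintype.sum_prod_type,
    sum_comm]
  refine sum_congr rfl fun y _ => ?_
  rw [sum_comm]
  rfl

/-- The third tensor power of an orthogonal matrix is orthogonal; `hδ` is the orthonormality of its
rows. -/
theorem sum_norm_sq_transform (O : Matrix.orthogonalGroup (Fin N) ℝ)
    (φ : (Fin 3 → Fin N) → ℂ) :
    ∑ a : Fin 3 → Fin N, ‖∑ x : Fin 3 → Fin N, ((∏ s, O.1 (x s) (a s) : ℝ) : ℂ) * φ x‖ ^ 2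
      = ∑ x, ‖φ x‖ ^ 2 := by
  have hδ : ∀ x x' : Fin 3 → Fin N,
      ∑ a : Fin 3 → Fin N, (∏ s, O.1 (x s) (a s)) * (∏ s, O.1 (x' s) (a s))
        = if x = x' then 1 else 0 := by
    intro x x'
    simp_rw [← prod_mul_distrib]
    rw [sum_prod_fin_three (fun s i => O.1 (x s) i * O.1 (x' s) i)]
    rw [prod_congr rfl fun s _ => orthogonal_sum_mul_row O (x s) (x' s)]
    by_cases h : x = x'
    · subst h; simp
    · obtain ⟨s, hs⟩ := Function.ne_iff.mp h
      rw [if_neg h]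
      exact prod_eq_zero (mem_univ s) (by rw [if_neg hs])
  apply Complex.ofReal_injective
  push_cast
  simp_rw [← Complex.conj_mul', map_sum, map_mul, map_prod, Complex.conj_ofReal, sum_mul_sum]
  rw [sum_comm]
  refine sum_congr rfl fun x _ => ?_
  rw [sum_comm, sum_eq_single x]
  · have := hδ x x
    rw [if_pos rfl] at this
    calc _ = ((∑ a : Fin 3 → Fin N, (∏ s, O.1 (x s) (a s)) * (∏ s, O.1 (x s) (a s)) : ℝ) : ℂ) *
          ((starRingEnd ℂ) (φ x) * φ x) := by
          push_cast
          rw [sum_mul]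
          exact sum_congr rfl fun a _ => by ring
      _ = _ := by rw [this]; push_cast; ring
  · intro x' _ hx'
    have := hδ x x'
    rw [if_neg (Ne.symm hx')] at this
    calc _ = ((∑ a : Fin 3 → Fin N, (∏ s, O.1 (x s) (a s)) * (∏ s, O.1 (x' s) (a s)) : ℝ) : ℂ) *
          ((starRingEnd ℂ) (φ x) * φ x') := by
          push_cast
          rw [sum_mul]
          exact sum_congr rfl fun a _ => by ring
      _ = _ := by rw [this]; push_cast; ring
  · simp

theorem sum_norm_sq_coeff (O : Matrix.orthogonalGroup (Fin N) ℝ) (Φ : State N r m) :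
    ∑ a, ∑ y, ‖coeff O.1 Φ a y‖ ^ 2 = ‖Φ‖ ^ 2 := by
  rw [EuclideanSpace.norm_sq_eq, sum_config, sum_comm]
  exact sum_congr rfl fun y _ => sum_norm_sq_transform O fun x => Φ (Sum.elim x y.1, y.2)

theorem tripleWeight_nonneg (O : Matrix (Fin N) (Fin N) ℝ) (Φ : State N r m) :
    0 ≤ tripleWeight O Φ :=
  sum_nonneg fun _ _ => sum_nonneg fun _ _ => sq_nonneg _

theorem tripleWeight_le (O : Matrix.orthogonalGroup (Fin N) ℝ) (Φ : State N r m) :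
    tripleWeight O.1 Φ ≤ ‖Φ‖ ^ 2 := by
  rw [← sum_norm_sq_coeff O Φ, tripleWeight]
  rw [← sum_image (s := univ) (g := fun i : Fin N => (fun _ : Fin 3 => i))
    (f := fun a => ∑ y, ‖coeff O.1 Φ a y‖ ^ 2) (fun i _ j _ h => congrFun h 0)]
  exact sum_le_sum_of_subset_of_nonneg (subset_univ _)
    fun _ _ _ => sum_nonneg fun _ _ => sq_nonneg _

/-- Taking third tensor powers is multiplicative. This expresses the coefficients along a rotated
basis through those along the original one. -/
theorem coeff_mul (O Q : Matrix (Fin N) (Fin N) ℝ) (Φ : State N r m) (a : Fin 3 → Fin N)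
    (y : (Fin r → Fin N) × (Fin m → Bool)) :
    coeff (O * Q) Φ a y = ∑ b : Fin 3 → Fin N, ((∏ s, Q (b s) (a s) : ℝ) : ℂ) * coeff O Φ b y := by
  have h : ∀ x : Fin 3 → Fin N, (∏ s, (O * Q) (x s) (a s))
      = ∑ b : Fin 3 → Fin N, (∏ s, O (x s) (b s)) * ∏ s, Q (b s) (a s) := by
    intro x
    simp_rw [Matrix.mul_apply, ← prod_mul_distrib]
    rw [sum_prod_fin_three (fun s i => O (x s) i * Q i (a s))]
  simp_rw [coeff, h, mul_sum]
  rw [sum_comm]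
  refine sum_congr rfl fun x _ => ?_
  rw [Complex.ofReal_sum, sum_mul]
  refine sum_congr rfl fun b _ => ?_
  push_cast
  ring

end Weights

/-! ### The operators: unitarity and invariance under rotations of eigenspaces -/

section Operators

open Finset

variable {t N r m : ℕ}

theorem operators_apply (O : Matrix.orthogonalGroup (Fin N) ℝ) (z : Fin N → Fin t → Circle)
    (j : Fin t) (k l : Fin N) :
    operators O z j k l = ∑ i, (O.1 k i : ℂ) * z i j * O.1 l i := by
  rw [operators, Matrix.mul_apply]
  refine sum_congr rfl fun i _ => ?_
  simp [Matrix.mul_diagonal]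

theorem map_ofReal_transpose_mul (O : Matrix.orthogonalGroup (Fin N) ℝ) :
    (O.1.map Complex.ofReal).transpose * O.1.map Complex.ofReal = 1 := by
  ext i j
  rw [Matrix.mul_apply]
  have := orthogonal_sum_mul_col O i j
  simp only [Matrix.transpose_apply, Matrix.map_apply, Matrix.one_apply]
  calc ∑ k, (O.1 k i : ℂ) * (O.1 k j : ℂ) = ((∑ k, O.1 k i * O.1 k j : ℝ) : ℂ) := by push_cast; rfl
    _ = if i = j then 1 else 0 := by rw [this]; split_ifs <;> simp

theorem map_ofReal_mul_transpose (O : Matrix.orthogonalGroup (Fin N) ℝ) :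
    O.1.map Complex.ofReal * (O.1.map Complex.ofReal).transpose = 1 :=
  mul_eq_one_comm.mp (map_ofReal_transpose_mul O)

theorem operators_mem_unitaryGroup (O : Matrix.orthogonalGroup (Fin N) ℝ)
    (z : Fin N → Fin t → Circle) (j : Fin t) :
    operators O z j ∈ Matrix.unitaryGroup (Fin N) ℂ := by
  rw [Matrix.mem_unitaryGroup_iff]
  have hR : ((O.1.map Complex.ofReal).transpose).conjTranspose = O.1.map Complex.ofReal := by
    ext; simp
  have hR' : (O.1.map Complex.ofReal).conjTranspose = (O.1.map Complex.ofReal).transpose := by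
    ext; simp
  rw [Matrix.star_eq_conjTranspose, operators, Matrix.conjTranspose_mul, Matrix.conjTranspose_mul,
    hR, hR', Matrix.diagonal_conjTranspose]
  have h1 := map_ofReal_transpose_mul O
  have h2 := map_ofReal_mul_transpose O
  set R := O.1.map Complex.ofReal
  calc R * Matrix.diagonal (fun i => (z i j : ℂ)) * R.transpose *
        (R * (Matrix.diagonal (star fun i => (z i j : ℂ)) * R.transpose))
      = R * (Matrix.diagonal (fun i => (z i j : ℂ)) * (R.transpose * R) *
          Matrix.diagonal (star fun i => (z i j : ℂ))) * R.transpose := by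
        simp only [Matrix.mul_assoc]
    _ = 1 := by
        rw [h1, Matrix.mul_one, Matrix.diagonal_mul_diagonal]
        have : (fun i => (z i j : ℂ) * (star fun i => (z i j : ℂ)) i) = fun _ => 1 := by
          funext i
          simp [Complex.mul_conj]
        rw [this, Matrix.diagonal_one, Matrix.mul_one, h2]

/-- A matrix mixing only indices with equal eigenvalue vectors commutes with the diagonal matrices,
and then cancels against its transpose. This is the freedom of choice of basis in a degenerate
eigenspace. -/
theorem operators_mul_of_block (O Q : Matrix.orthogonalGroup (Fin N) ℝ)
    (z : Fin N → Fin t → Circle) (h : ∀ a b, Q.1 a b ≠ 0 → z a = z b) :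
    operators (O * Q) z = operators O z := by
  funext j
  have hmap : (O * Q).1.map Complex.ofReal = O.1.map Complex.ofReal * Q.1.map Complex.ofReal := by
    ext a b
    simp [Matrix.mul_apply]
  have hcomm : Q.1.map Complex.ofReal * Matrix.diagonal (fun i => (z i j : ℂ))
      = Matrix.diagonal (fun i => (z i j : ℂ)) * Q.1.map Complex.ofReal := by
    ext a b
    rw [Matrix.mul_diagonal, Matrix.diagonal_mul, Matrix.map_apply]
    by_cases hab : Q.1 a b = 0
    · simp [hab]
    · rw [h a b hab, mul_comm]
  rw [operators, operators, hmap, Matrix.transpose_mul]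
  have h2 := map_ofReal_mul_transpose Q
  set R := O.1.map Complex.ofReal
  set S := Q.1.map Complex.ofReal
  calc R * S * Matrix.diagonal (fun i => (z i j : ℂ)) * (S.transpose * R.transpose)
      = R * (S * Matrix.diagonal (fun i => (z i j : ℂ))) * (S.transpose * R.transpose) := by
        simp only [Matrix.mul_assoc]
    _ = R * Matrix.diagonal (fun i => (z i j : ℂ)) * (S * S.transpose) * R.transpose := by
        rw [hcomm]; simp only [Matrix.mul_assoc]
    _ = _ := by rw [h2, Matrix.mul_one]

end Operators

/-! ### Circuits: norm preservation, dependence on the eigenvalues, continuity -/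

section Circuits

open Finset

variable {t N r m : ℕ}

theorem sum_norm_sq_mulVec {κ : Type*} [Fintype κ] [DecidableEq κ] {W : Matrix κ κ ℂ}
    (hW : W ∈ Matrix.unitaryGroup κ ℂ) (u : κ → ℂ) :
    ∑ x, ‖W.mulVec u x‖ ^ 2 = ∑ x, ‖u x‖ ^ 2 := by
  have key : ∀ v : κ → ℂ, ((∑ x, ‖v x‖ ^ 2 : ℝ) : ℂ) = star v ⬝ᵥ v := by
    intro v
    push_cast
    simp_rw [← Complex.conj_mul']
    rfl
  apply Complex.ofReal_injective
  rw [key, key, Matrix.star_mulVec, ← Matrix.dotProduct_mulVec, Matrix.mulVec_mulVec,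
    ← Matrix.star_eq_conjTranspose, Matrix.mem_unitaryGroup_iff'.mp hW, Matrix.one_mulVec]

theorem sum_norm_sq_register {ι : Type*} [Fintype ι] [DecidableEq ι]
    {W : Matrix (Fin N) (Fin N) ℂ} (hW : W ∈ Matrix.unitaryGroup (Fin N) ℂ) (s : ι)
    (g : (ι → Fin N) → ℂ) :
    ∑ p : ι → Fin N, ‖∑ k, W (p s) k * g (Function.update p s k)‖ ^ 2 = ∑ p, ‖g p‖ ^ 2 := by
  rw [← (Equiv.funSplitAt s (Fin N)).symm.sum_comp, ← (Equiv.funSplitAt s (Fin N)).symm.sum_comp,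
    Fintype.sum_prod_type, Fintype.sum_prod_type, sum_comm, sum_comm (γ := Fin N)]
  refine sum_congr rfl fun q _ => ?_
  rw [← sum_norm_sq_mulVec hW fun k => g ((Equiv.funSplitAt s (Fin N)).symm (k, q))]
  refine sum_congr rfl fun v _ => ?_
  have h1 : (Equiv.funSplitAt s (Fin N)).symm (v, q) s = v := by simp
  have h2 : ∀ k, Function.update ((Equiv.funSplitAt s (Fin N)).symm (v, q)) s k
      = (Equiv.funSplitAt s (Fin N)).symm (k, q) := by
    intro k
    funext i
    by_cases hi : i = s
    · subst hi; simp
    · simp [hi]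
  exact congrArg (‖·‖ ^ 2) (sum_congr rfl fun k _ =>
    congrArg₂ (· * ·) (congrArg (fun i => W i k) h1) (congrArg g (h2 k)))

theorem norm_gate_apply {U : Fin t → Matrix (Fin N) (Fin N) ℂ}
    (hU : ∀ j, U j ∈ Matrix.unitaryGroup (Fin N) ℂ) (g : Gate t N r m) (Φ : State N r m) :
    ‖Gate.apply U g Φ‖ = ‖Φ‖ := by
  rw [← sq_eq_sq₀ (norm_nonneg _) (norm_nonneg _), EuclideanSpace.norm_sq_eq,
    EuclideanSpace.norm_sq_eq]
  cases g with
  | standard W => exact sum_norm_sq_mulVec W.2 _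
  | controlled j c s =>
    rw [Fintype.sum_prod_type_right, Fintype.sum_prod_type_right]
    refine sum_congr rfl fun b _ => ?_
    by_cases hb : b c = true
    · simp only [Gate.apply, hb, if_true]
      exact sum_norm_sq_register (hU j) s fun p => Φ (p, b)
    · simp only [Gate.apply, hb]
      rfl

theorem output_append_singleton [NeZero N] (C : Circuit t N r m) (g : Gate t N r m)
    (U : Fin t → Matrix (Fin N) (Fin N) ℂ) :
    Circuit.output (C ++ [g] : List _) U = Gate.apply U g (C.output U) := by
  simp [Circuit.output]

theorem norm_output [NeZero N] (C : Circuit t N r m) {U : Fin t → Matrix (Fin N) (Fin N) ℂ}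
    (hU : ∀ j, U j ∈ Matrix.unitaryGroup (Fin N) ℂ) : ‖C.output U‖ = 1 := by
  induction C using List.reverseRecOn with
  | nil => simp [Circuit.output, initialState]
  | append_singleton C g ih => rw [output_append_singleton, norm_gate_apply hU, ih]

/-- Standard gates combine amplitudes linearly. A controlled gate multiplies them by entries of
`U_j`, each a sum over `i` of functions of the single coordinate `z i`, so a query adds one
coordinate. -/
theorem output_mem_junta [NeZero N] (C : Circuit t N r m) (O : Matrix.orthogonalGroup (Fin N) ℝ)
    (x : Config N r m) :
    (fun z : Fin N → Fin t → Circle => C.output (operators O z) x)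
      ∈ junta (Fin t → Circle) (Fin N) C.queries := by
  induction C using List.reverseRecOn generalizing x with
  | nil => exact const_mem_junta _
  | append_singleton C g ih =>
    simp only [output_append_singleton]
    cases g with
    | standard W =>
      have hq : Circuit.queries (C ++ [Gate.standard W] : List _) = Circuit.queries C := by
        simp [Circuit.queries, Gate.isQuery]
      rw [hq]
      have e : (fun z : Fin N → Fin t → Circle =>
          Gate.apply (operators O z) (Gate.standard W) (Circuit.output C (operators O z)) x)
          = ∑ x', W.1 x x' • fun z => Circuit.output C (operators O z) x' := by
        funext z
        simp [Gate.apply, Matrix.mulVec, dotProduct]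
      rw [e]
      exact Submodule.sum_mem _ fun x' _ => Submodule.smul_mem _ _ (ih x')
    | controlled j c s =>
      have hq : Circuit.queries (C ++ [Gate.controlled j c s] : List _)
          = 1 + Circuit.queries C := by
        simp [Circuit.queries, Gate.isQuery, add_comm]
      rw [hq]
      by_cases hc : x.2 c = true
      · have e : (fun z : Fin N → Fin t → Circle =>
            Gate.apply (operators O z) (Gate.controlled j c s)
              (Circuit.output C (operators O z)) x)
            = ∑ k, (fun z => operators O z j (x.1 s) k) *
              fun z => Circuit.output C (operators O z) (Function.update x.1 s k, x.2) := by
          funext z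
          simp [Gate.apply, hc]
        rw [e]
        refine Submodule.sum_mem _ fun k _ => mul_mem_junta ?_ (ih _)
        have e' : (fun z : Fin N → Fin t → Circle => operators O z j (x.1 s) k)
            = ∑ i, ((O.1 (x.1 s) i : ℂ) * O.1 k i) • fun z => (z i j : ℂ) := by
          funext z
          rw [operators_apply, Finset.sum_apply]
          exact sum_congr rfl fun i _ => by simp; ring
        rw [e']
        refine Submodule.sum_mem _ fun i _ => Submodule.smul_mem _ _ ?_
        exact apply_mem_junta (h := fun v : Fin t → Circle => (v j : ℂ)) (by fun_prop) i
      · have e : (fun z : Fin N → Fin t → Circle =>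
            Gate.apply (operators O z) (Gate.controlled j c s)
              (Circuit.output C (operators O z)) x)
            = fun z => Circuit.output C (operators O z) x := by
          funext z
          simp [Gate.apply, hc]
        rw [e]
        exact junta_mono (by omega) (ih x)

/-- Squared moduli are products of amplitudes with their conjugates, which doubles the number of
coordinates. -/
theorem tripleWeight_mem_junta [NeZero N] (C : Circuit t N r m)
    (O : Matrix.orthogonalGroup (Fin N) ℝ) :
    (fun z : Fin N → Fin t → Circle => (tripleWeight O.1 (C.output (operators O z)) : ℂ))
      ∈ junta (Fin t → Circle) (Fin N) (C.queries + C.queries) := by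
  have hcoeff : ∀ a y, (fun z : Fin N → Fin t → Circle => coeff O.1 (C.output (operators O z)) a y)
      ∈ junta (Fin t → Circle) (Fin N) C.queries := by
    intro a y
    have e : (fun z : Fin N → Fin t → Circle => coeff O.1 (C.output (operators O z)) a y)
        = ∑ x : Fin 3 → Fin N, ((∏ s, O.1 (x s) (a s) : ℝ) : ℂ) •
          fun z => C.output (operators O z) (Sum.elim x y.1, y.2) := by
      funext z
      simp [coeff]
    rw [e]
    exact Submodule.sum_mem _ fun x _ => Submodule.smul_mem _ _ (output_mem_junta C O _)
  have e : (fun z : Fin N → Fin t → Circle => (tripleWeight O.1 (C.output (operators O z)) : ℂ))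
      = ∑ i, ∑ y, star (fun z => coeff O.1 (C.output (operators O z)) (fun _ => i) y) *
          fun z => coeff O.1 (C.output (operators O z)) (fun _ => i) y := by
    funext z
    simp [tripleWeight, Finset.sum_apply, Complex.conj_mul']
  rw [e]
  exact Submodule.sum_mem _ fun i _ => Submodule.sum_mem _ fun y _ =>
    mul_mem_junta (star_mem_junta (hcoeff _ _)) (hcoeff _ _)

theorem continuous_orthogonal_entry (k i : Fin N) :
    Continuous fun O : Matrix.orthogonalGroup (Fin N) ℝ => O.1 k i :=
  (continuous_apply_apply k i).comp continuous_subtype_val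

theorem continuous_operators (j : Fin t) (k l : Fin N) :
    Continuous fun ω : Matrix.orthogonalGroup (Fin N) ℝ × (Fin N → Fin t → Circle) =>
      operators ω.1 ω.2 j k l := by
  simp_rw [operators_apply]
  refine continuous_finsetSum _ fun i _ => ?_
  have h1 := (Complex.continuous_ofReal.comp (continuous_orthogonal_entry (N := N) k i)).comp
    (continuous_fst (Y := Fin N → Fin t → Circle))
  have h2 := (Complex.continuous_ofReal.comp (continuous_orthogonal_entry (N := N) l i)).comp
    (continuous_fst (Y := Fin N → Fin t → Circle))
  have h3 : Continuous fun ω : Matrix.orthogonalGroup (Fin N) ℝ × (Fin N → Fin t → Circle) =>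
    ((ω.2 i j : Circle) : ℂ) := by fun_prop
  exact (h1.mul h3).mul h2

theorem continuous_output [NeZero N] (C : Circuit t N r m) (x : Config N r m) :
    Continuous fun ω : Matrix.orthogonalGroup (Fin N) ℝ × (Fin N → Fin t → Circle) =>
      C.output (operators ω.1 ω.2) x := by
  induction C using List.reverseRecOn generalizing x with
  | nil => exact continuous_const
  | append_singleton C g ih =>
    simp only [output_append_singleton]
    cases g with
    | standard W =>
      simp only [Gate.apply, Matrix.mulVec, dotProduct]
      exact continuous_finsetSum _ fun x' _ => continuous_const.mul (ih x')
    | controlled j c s =>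
      by_cases hc : x.2 c = true
      · simp only [Gate.apply, hc, if_true]
        exact continuous_finsetSum _ fun k _ => (continuous_operators j _ _).mul (ih _)
      · simp only [Gate.apply, hc]
        exact ih x

theorem continuous_tripleWeight [NeZero N] (C : Circuit t N r m) :
    Continuous fun ω : Matrix.orthogonalGroup (Fin N) ℝ × (Fin N → Fin t → Circle) =>
      tripleWeight ω.1.1 (C.output (operators ω.1 ω.2)) := by
  unfold tripleWeight coeff
  refine continuous_finsetSum _ fun i _ => continuous_finsetSum _ fun y _ => ?_
  refine (Continuous.norm ?_).pow 2
  refine continuous_finsetSum _ fun x _ => Continuous.mul ?_ (continuous_output C _)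
  refine Complex.continuous_ofReal.comp (continuous_finsetProd _ fun s _ => ?_)
  exact (continuous_orthogonal_entry (x s) i).comp continuous_fst

end Circuits

/-! ### The solution space for distinct eigenvalue vectors -/

section SolutionSpace

open Finset

variable {t N r m : ℕ}

theorem coeff_tripleState (O : Matrix.orthogonalGroup (Fin N) ℝ) (i i' : Fin N)
    (w : (Fin r → Fin N) × (Fin m → Bool) → ℂ) (y : (Fin r → Fin N) × (Fin m → Bool)) :
    coeff O.1 (tripleState (basisVec O i) w) (fun _ => i') y = if i' = i then w y else 0 := by
  have h : ∑ x : Fin 3 → Fin N, (∏ s, O.1 (x s) i') * (∏ s, O.1 (x s) i)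
      = if i' = i then 1 else 0 := by
    simp_rw [← prod_mul_distrib]
    rw [sum_prod_fin_three (fun _ k => O.1 k i' * O.1 k i)]
    simp_rw [orthogonal_sum_mul_col]
    split_ifs <;> simp
  calc coeff O.1 (tripleState (basisVec O i) w) (fun _ => i') y
      = ((∑ x : Fin 3 → Fin N, (∏ s, O.1 (x s) i') * (∏ s, O.1 (x s) i) : ℝ) : ℂ) * w y := by
        rw [coeff]
        push_cast
        rw [sum_mul]
        refine sum_congr rfl fun x _ => ?_
        simp [tripleState, basisVec, Fin.prod_univ_three]
        ring
    _ = _ := by rw [h]; split_ifs <;> simp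

theorem inner_tripleState_single (O : Matrix.orthogonalGroup (Fin N) ℝ) (i : Fin N)
    (y : (Fin r → Fin N) × (Fin m → Bool)) (Φ : State N r m) :
    inner ℂ (tripleState (basisVec O i) (Pi.single y 1)) Φ = coeff O.1 Φ (fun _ => i) y := by
  rw [PiLp.inner_apply, sum_config, sum_eq_single y]
  · rw [coeff]
    refine sum_congr rfl fun x _ => ?_
    simp [tripleState, basisVec, Fin.prod_univ_three]
    ring
  · intro y' _ hy'
    refine sum_eq_zero fun x _ => ?_
    have : ((fun i => (Sum.elim x y'.1 : Fin 3 ⊕ Fin r → Fin N) (Sum.inr i)), y'.2) = y' := rfl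
    simp [tripleState, hy']
  · simp

theorem orthonormal_tripleState (O : Matrix.orthogonalGroup (Fin N) ℝ) :
    Orthonormal ℂ (fun p : Fin N × ((Fin r → Fin N) × (Fin m → Bool)) =>
      (tripleState (basisVec O p.1) (Pi.single p.2 1) : State N r m)) := by
  rw [orthonormal_iff_ite]
  rintro ⟨i, y⟩ ⟨i', y'⟩
  rw [inner_tripleState_single, coeff_tripleState]
  by_cases h : i = i' <;> by_cases h' : y = y' <;> simp [h, h']

/-- In the coordinates `a` of `ψ` along the columns, the eigenvalue equations read `z i j * a i = μ
j * a i`. Two nonzero coordinates would have the same eigenvalue vector, which injectivity forbids.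
-/
theorem exists_eq_smul_basisVec (O : Matrix.orthogonalGroup (Fin N) ℝ)
    {z : Fin N → Fin t → Circle} (hz : Function.Injective z) {ψ : Fin N → ℂ}
    (hψ : IsCommonEigenvector (operators O z) ψ) : ∃ (i : Fin N) (c : ℂ), ψ = c • basisVec O i := by
  obtain ⟨hne, heig⟩ := hψ
  choose μ hμ using heig
  set a := (O.1.map Complex.ofReal).transpose.mulVec ψ with ha
  have hψa : ψ = (O.1.map Complex.ofReal).mulVec a := by
    rw [ha, Matrix.mulVec_mulVec, map_ofReal_mul_transpose, Matrix.one_mulVec]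
  have hza : ∀ i j, (z i j : ℂ) * a i = μ j * a i := by
    intro i j
    have h := congrArg (O.1.map Complex.ofReal).transpose.mulVec (hμ j)
    rw [operators, Matrix.mulVec_mulVec, ← Matrix.mul_assoc, ← Matrix.mul_assoc,
      map_ofReal_transpose_mul, Matrix.one_mul, ← Matrix.mulVec_mulVec, Matrix.mulVec_smul] at h
    have := congrFun h i
    simpa [Matrix.mulVec_diagonal, ha] using this
  obtain ⟨i, hi⟩ : ∃ i, a i ≠ 0 := by
    by_contra! h
    apply hne
    rw [hψa, show a = 0 from funext h, Matrix.mulVec_zero]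
  refine ⟨i, a i, ?_⟩
  have hother : ∀ k, k ≠ i → a k = 0 := by
    intro k hk
    by_contra hak
    apply hk
    apply hz
    funext j
    apply Circle.ext
    rw [mul_right_cancel₀ hak (hza k j), mul_right_cancel₀ hi (hza i j)]
  rw [hψa]
  funext k
  simp only [Matrix.mulVec, dotProduct, Pi.smul_apply, smul_eq_mul, basisVec]
  rw [sum_eq_single i (fun l _ hl => by rw [hother l hl, mul_zero]) (by simp)]
  simp [mul_comm]

theorem isCommonEigenvector_basisVec (O : Matrix.orthogonalGroup (Fin N) ℝ)
    (z : Fin N → Fin t → Circle) (i : Fin N) :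
    IsCommonEigenvector (operators O z) (basisVec O i) := by
  refine ⟨fun h => ?_, fun j => ⟨z i j, operators_mulVec_basisVec O z j i⟩⟩
  have h1 := orthogonal_sum_mul_col O i i
  rw [if_pos rfl] at h1
  have h2 : ∀ k, O.1 k i = 0 := fun k => by
    have := congrFun h k
    simpa [basisVec] using this
  simp [h2] at h1

/-- When the joint eigenspaces are lines, the states made of three copies of a column and a
computational basis state of the rest form an orthonormal basis of the solution space. The squared
norm of the projection is the sum of the squared coefficients. -/
theorem successProb_eq_tripleWeight [NeZero N] (C : Circuit t N r m)
    (O : Matrix.orthogonalGroup (Fin N) ℝ) {z : Fin N → Fin t → Circle}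
    (hz : Function.Injective z) :
    C.successProb (operators O z) = tripleWeight O.1 (C.output (operators O z)) := by
  set Φ := C.output (operators O z) with hΦ
  have hon := orthonormal_tripleState (r := r) (m := m) O
  set b : Fin N × ((Fin r → Fin N) × (Fin m → Bool)) → State N r m :=
    fun p => tripleState (basisVec O p.1) (Pi.single p.2 1) with hb
  have hproj : (solutionSpace r m (operators O z)).starProjection Φ
      = ∑ p, coeff O.1 Φ (fun _ => p.1) p.2 • b p := by
    refine Submodule.eq_starProjection_of_mem_of_inner_eq_zero ?_ ?_
    · refine Submodule.sum_mem _ fun p _ => Submodule.smul_mem _ _ (Submodule.subset_span ?_)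
      exact ⟨_, _, isCommonEigenvector_basisVec O z p.1, rfl⟩
    · intro w hw
      have hbz : ∀ p, inner ℂ (Φ - ∑ p, coeff O.1 Φ (fun _ => p.1) p.2 • b p) (b p) = 0 := by
        intro p
        rw [inner_sub_left, hon.inner_left_fintype, ← inner_conj_symm, inner_tripleState_single,
          sub_self]
      induction hw using Submodule.span_induction with
      | mem w hw =>
        obtain ⟨ψ, u, hψ, rfl⟩ := hw
        obtain ⟨i, c, rfl⟩ := exists_eq_smul_basisVec O hz hψ
        -- `tripleState` is cubic in its first argument, whence `c ^ 3`, and linear in the second.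
        have : (tripleState (c • basisVec O i) u : State N r m)
            = ∑ y, (c ^ 3 * u y) • b (i, y) := by
          ext x
          rw [WithLp.ofLp_sum, Finset.sum_apply, sum_eq_single ((fun i => x.1 (Sum.inr i)), x.2)]
          · simp [tripleState, hb]
            ring
          · intro y _ hy
            simp [tripleState, hb, Ne.symm hy]
          · simp
        rw [this, inner_sum]
        exact sum_eq_zero fun y _ => by rw [inner_smul_right, hbz, mul_zero]
      | zero => exact inner_zero_right _
      | add w w' _ _ h h' => rw [inner_add_right, h, h', add_zero]
      | smul c w _ h => rw [inner_smul_right, h, mul_zero]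
  rw [Circuit.successProb, ← hΦ, hproj]
  apply Complex.ofReal_injective
  push_cast
  rw [← RCLike.ofReal_eq_complex_ofReal, ← inner_self_eq_norm_sq_to_K (𝕜 := ℂ), hon.inner_sum]
  simp [tripleWeight, Fintype.sum_prod_type, Complex.conj_mul']

end SolutionSpace

end BlackBoxMoney

/-! ### Flat real orthogonal matrices from the Hartley transform -/

section Hartley

open Finset

theorem sum_exp_root {K : ℕ} (hK : 0 < K) (j : ℤ) :
    ∑ n ∈ range K, Complex.exp ((2 * Real.pi * j * n / K : ℝ) * Complex.I)
      = if (K : ℤ) ∣ j then (K : ℂ) else 0 := by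
  have hK' : (K : ℂ) ≠ 0 := by exact_mod_cast hK.ne'
  set η := Complex.exp (2 * Real.pi * Complex.I * (j / K)) with hη
  have hpow : ∀ n : ℕ, Complex.exp ((2 * Real.pi * j * n / K : ℝ) * Complex.I) = η ^ n := by
    intro n
    rw [hη, ← Complex.exp_nat_mul]
    congr 1
    push_cast
    ring
  simp_rw [hpow]
  have hηK : η ^ K = 1 := by
    rw [hη, ← Complex.exp_nat_mul, Complex.exp_eq_one_iff]
    exact ⟨j, by field_simp⟩
  split_ifs with h
  · obtain ⟨l, rfl⟩ := h
    have : η = 1 := by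
      rw [hη, Complex.exp_eq_one_iff]
      exact ⟨l, by push_cast; field_simp⟩
    simp [this]
  · have hne : η ≠ 1 := by
      intro h1
      rw [hη, Complex.exp_eq_one_iff] at h1
      obtain ⟨l, hl⟩ := h1
      apply h
      refine ⟨l, ?_⟩
      have h2 : (2 * (Real.pi : ℂ) * Complex.I) ≠ 0 := Complex.two_pi_I_ne_zero
      have h3 : (j : ℂ) / K = l := by
        apply mul_left_cancel₀ h2
        rw [hl]; ring
      rw [div_eq_iff hK'] at h3
      have h4 : j = l * K := by exact_mod_cast h3
      rw [h4, mul_comm]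
    rw [geom_sum_eq hne, hηK, sub_self, zero_div]

theorem sum_cos_root {K : ℕ} (hK : 0 < K) (j : ℤ) :
    ∑ n ∈ range K, Real.cos (2 * Real.pi * j * n / K) = if (K : ℤ) ∣ j then (K : ℝ) else 0 := by
  have h := congrArg Complex.re (sum_exp_root hK j)
  rw [Complex.re_sum] at h
  simp_rw [Complex.exp_ofReal_mul_I_re] at h
  rw [h]
  split_ifs <;> simp

theorem sum_sin_root {K : ℕ} (hK : 0 < K) (j : ℤ) :
    ∑ n ∈ range K, Real.sin (2 * Real.pi * j * n / K) = 0 := by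
  have h := congrArg Complex.im (sum_exp_root hK j)
  rw [Complex.im_sum] at h
  simp_rw [Complex.exp_ofReal_mul_I_im] at h
  rw [h]
  split_ifs <;> simp

/-- The kernel of the Hartley transform. -/
noncomputable def cas (x : ℝ) : ℝ := Real.cos x + Real.sin x

theorem cas_sq_le (x : ℝ) : cas x ^ 2 ≤ 2 := by
  unfold cas
  nlinarith [sq_nonneg (Real.cos x - Real.sin x), Real.sin_sq_add_cos_sq x]

/-- The product of the two kernels is the cosine of the difference plus the sine of the sum of the
angles; over a full period the sines cancel and the cosines detect `p = q`. The Hartley kernel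
replaces the Fourier kernel because the rotation must be real, and it is available in every size. -/
theorem sum_cas_mul_cas {K p q : ℕ} (hp : p < K) (hq : q < K) :
    ∑ n ∈ range K, cas (2 * Real.pi * p * n / K) * cas (2 * Real.pi * q * n / K)
      = if p = q then (K : ℝ) else 0 := by
  have hK : 0 < K := by omega
  have h1 := sum_cos_root hK ((p : ℤ) - q)
  have h2 := sum_sin_root hK ((p : ℤ) + q)
  have hdvd : (K : ℤ) ∣ (p : ℤ) - q ↔ p = q := by
    constructor
    · intro h
      have := Int.eq_zero_of_abs_lt_dvd h (by rw [abs_lt]; omega)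
      omega
    · rintro rfl; simp
  have e : ∀ n : ℕ, cas (2 * Real.pi * p * n / K) * cas (2 * Real.pi * q * n / K)
      = Real.cos (2 * Real.pi * ((p : ℤ) - q : ℤ) * n / K)
        + Real.sin (2 * Real.pi * ((p : ℤ) + q : ℤ) * n / K) := by
    intro n
    have a1 : 2 * Real.pi * ((p : ℤ) - q : ℤ) * n / K
        = 2 * Real.pi * p * n / K - 2 * Real.pi * q * n / K := by push_cast; ring
    have a2 : 2 * Real.pi * ((p : ℤ) + q : ℤ) * n / K
        = 2 * Real.pi * p * n / K + 2 * Real.pi * q * n / K := by push_cast; ring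
    rw [a1, a2, Real.cos_sub, Real.sin_add]
    unfold cas
    ring
  rw [sum_congr rfl fun n _ => e n, sum_add_distrib, h1, h2, add_zero]
  simp only [hdvd]

theorem exists_rank {α β : Type*} [Fintype α] [DecidableEq β] (f : α → β) :
    ∃ ρ : α → ℕ, ∀ b, Set.BijOn ρ (univ.filter (f · = b) : Finset α)
      (range #(univ.filter (f · = b))) := by
  classical
  let ρ : α → ℕ := fun a => ((univ.filter (f · = f a)).equivFin ⟨a, by simp⟩ : ℕ)
  have key : ∀ b a (h : a ∈ univ.filter (f · = b)),
      ρ a = ((univ.filter (f · = b)).equivFin ⟨a, h⟩ : ℕ) := by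
    intro b a h
    have hb : f a = b := (mem_filter.mp h).2
    subst hb
    rfl
  refine ⟨ρ, fun b => ⟨?_, ?_, ?_⟩⟩
  · intro a ha
    rw [coe_range, Set.mem_Iio, key b a ha]
    exact Fin.is_lt _
  · intro a ha a' ha' h
    rw [key b a ha, key b a' ha'] at h
    simpa using (univ.filter (f · = b)).equivFin.injective (Fin.ext h)
  · intro n hn
    rw [coe_range, Set.mem_Iio] at hn
    obtain ⟨a, ha⟩ := (univ.filter (f · = b)).equivFin.surjective ⟨n, hn⟩
    exact ⟨a, a.2, by rw [key b a a.2, ha]⟩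

/-- There are orthogonal matrices, block diagonal for a given partition, with entries of the order
of the inverse square root of the block size. -/
theorem exists_flat_block_orthogonal {N : ℕ} {β : Type*} [DecidableEq β] (f : Fin N → β) :
    ∃ H : Matrix.orthogonalGroup (Fin N) ℝ,
      (∀ a b, f a ≠ f b → H.1 a b = 0) ∧
      ∀ a b, H.1 a b ^ 2 ≤ 2 / #(univ.filter (f · = f b)) := by
  obtain ⟨ρ, hρ⟩ := exists_rank f
  let K : β → ℕ := fun b => #(univ.filter (f · = b))
  have hKpos : ∀ a, 0 < K (f a) := fun a => card_pos.mpr ⟨a, by simp⟩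
  let M : Matrix (Fin N) (Fin N) ℝ := Matrix.of fun a b => if f a = f b then
    cas (2 * Real.pi * ρ a * ρ b / K (f b)) / √(K (f b)) else 0
  have hM : M ∈ Matrix.orthogonalGroup (Fin N) ℝ := by
    rw [Matrix.mem_orthogonalGroup_iff]
    ext a c
    rw [Matrix.mul_apply, Matrix.one_apply]
    change ∑ b, M a b * M c b = _
    by_cases hac : f a = f c
    · have hρa : ρ a < K (f a) := by
        have := (hρ (f a)).1 (x := a) (by simp)
        simpa using this
      have hρc : ρ c < K (f a) := by
        have := (hρ (f a)).1 (x := c) (by simp [hac])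
        simpa using this
      have hk : (0 : ℝ) < K (f a) := by exact_mod_cast hKpos a
      calc ∑ b, M a b * M c b = ∑ b ∈ univ.filter (f · = f a),
            cas (2 * Real.pi * ρ a * ρ b / K (f a)) * cas (2 * Real.pi * ρ c * ρ b / K (f a))
              / K (f a) := by
            rw [sum_filter]
            refine sum_congr rfl fun b _ => ?_
            by_cases hb : f b = f a
            · simp only [M, Matrix.of_apply, hb, ← hac, if_true]
              rw [div_mul_div_comm, Real.mul_self_sqrt hk.le]
            · have hb' : ¬ f a = f b := fun h => hb h.symm
              simp [M, Matrix.of_apply, hb, hb']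
        _ = ∑ n ∈ range (K (f a)),
            cas (2 * Real.pi * ρ a * n / K (f a)) * cas (2 * Real.pi * ρ c * n / K (f a))
              / K (f a) := by
            refine sum_nbij ρ ?_ (hρ (f a)).2.1 (hρ (f a)).2.2 (fun _ _ => rfl)
            intro b hb
            exact (hρ (f a)).1 hb
        _ = (if ρ a = ρ c then (K (f a) : ℝ) else 0) / K (f a) := by
            rw [← sum_div, sum_cas_mul_cas hρa hρc]
        _ = if a = c then 1 else 0 := by
            have hiff : ρ a = ρ c ↔ a = c :=
              ⟨fun h => (hρ (f a)).2.1 (by simp) (by simp [hac]) h, fun h => by rw [h]⟩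
            by_cases h : a = c
            · rw [if_pos (hiff.mpr h), if_pos h, div_self hk.ne']
            · rw [if_neg (fun h' => h (hiff.mp h')), if_neg h, zero_div]
    · rw [if_neg fun h => hac (by rw [h])]
      refine sum_eq_zero fun b _ => ?_
      by_cases hb : f a = f b
      · have : ¬ f c = f b := fun h => hac (hb.trans h.symm)
        simp [M, Matrix.of_apply, this]
      · simp [M, Matrix.of_apply, hb]
  refine ⟨⟨M, hM⟩, fun a b h => by simp [M, Matrix.of_apply, h], fun a b => ?_⟩
  change M a b ^ 2 ≤ 2 / (K (f b) : ℝ)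
  have hk : (0 : ℝ) < K (f b) := by exact_mod_cast hKpos b
  by_cases h : f a = f b
  · simp only [M, Matrix.of_apply, h, if_true]
    rw [div_pow, Real.sq_sqrt hk.le]
    gcongr
    exact cas_sq_le _
  · rw [show M a b = 0 from if_neg h, zero_pow two_ne_zero]
    exact (div_pos two_pos hk).le

end Hartley

/-! ### Second moment of a cubic Rademacher chaos -/

section Signs

open Finset

variable {ι : Type*}

/-- The product of six signs. -/
def signChar (b b' : Fin 3 → ι) : (ι → ℤˣ) →* ℤˣ where
  toFun ε := (∏ s, ε (b s)) * ∏ s, ε (b' s)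
  map_one' := by simp
  map_mul' ε δ := by simp only [Pi.mul_apply, prod_mul_distrib]; exact mul_mul_mul_comm _ _ _ _

theorem signChar_comm (b b' : Fin 3 → ι) (ε : ι → ℤˣ) : signChar b b' ε = signChar b' b ε :=
  mul_comm _ _

variable [DecidableEq ι]

/-- The triples that can be paired off with a given triple. -/
def pairable (b : Fin 3 → ι) (B : Finset ι) : Finset (Fin 3 → ι) :=
  univ.image (fun σ : Fin 3 → Fin 3 => b ∘ σ) ∪
    (univ ×ˢ univ ×ˢ B).image
      (fun p : Fin 3 × Fin 3 × ι => Function.update (fun _ => p.2.2) p.1 (b p.2.1))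

theorem card_pairable_le {b : Fin 3 → ι} {B : Finset ι} (hB : 0 < #B) :
    #(pairable b B) ≤ 36 * #B := by
  refine (card_union_le _ _).trans ?_
  have h1 : #(univ.image (fun σ : Fin 3 → Fin 3 => b ∘ σ)) ≤ 27 :=
    card_image_le.trans (by simp)
  have h2 := card_image_le (s := (univ ×ˢ univ ×ˢ B))
    (f := fun p : Fin 3 × Fin 3 × ι => Function.update (fun _ : Fin 3 => p.2.2) p.1 (b p.2.1))
  simp only [card_product, card_univ, Fintype.card_fin] at h2
  omega

variable [Fintype ι]

/-- Translation by `δ` permutes the sign vectors and negates the character. -/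
theorem sum_signChar_eq_zero {b b' : Fin 3 → ι} {δ : ι → ℤˣ} (h : signChar b b' δ ≠ 1) :
    ∑ ε, ((signChar b b' ε : ℤ) : ℝ) = 0 := by
  have h1 : signChar b b' δ = -1 := (Int.units_eq_one_or _).resolve_left h
  have h2 := Equiv.sum_comp (Equiv.mulLeft δ) fun ε => ((signChar b b' ε : ℤ) : ℝ)
  simp only [Equiv.coe_mulLeft, map_mul, h1] at h2
  simp only [neg_mul, one_mul, Units.val_neg, Int.cast_neg, sum_neg_distrib] at h2
  linarith

theorem abs_sum_signChar_le (b b' : Fin 3 → ι) :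
    |∑ ε, ((signChar b b' ε : ℤ) : ℝ)| ≤ 2 ^ Fintype.card ι := by
  refine (abs_sum_le_sum_abs _ _).trans ?_
  have : ∀ u : ℤˣ, |((u : ℤ) : ℝ)| = 1 := fun u => by
    rcases Int.units_eq_one_or u with rfl | rfl <;> simp
  simp [this]

/-- If the sum is nonzero, flipping the sign at any single point `v` leaves the character unchanged,
so every `v` occurs an even number of times among the six entries. If two entries of `b'` agree, the
third must occur in `b`; if all three differ, each occurs in `b`. These are the two kinds of triples
in `pairable`. -/
theorem mem_pairable_of_sum_ne_zero {b b' : Fin 3 → ι} {B : Finset ι} (hb' : ∀ s, b' s ∈ B)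
    (h : ∑ ε, ((signChar b b' ε : ℤ) : ℝ) ≠ 0) : b' ∈ pairable b B := by
  have hδ : ∀ v, signChar b b' (fun x => if x = v then -1 else 1) = 1 := by
    intro v
    by_contra hne
    exact h (sum_signChar_eq_zero hne)
  have hrange : ∀ s s₁ s₂ : Fin 3, s₁ ≠ s → s₂ ≠ s → s₁ ≠ s₂ → (∃ j, b j = b' s) ∨
      b' s = b' s₁ ∨ b' s = b' s₂ := by
    intro s s₁ s₂ h1 h2 h3
    by_contra! hcon
    obtain ⟨hc0, hc1, hc2⟩ := hcon
    have := hδ (b' s)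
    simp only [signChar, MonoidHom.coe_mk, OneHom.coe_mk] at this
    rw [prod_eq_one (fun j _ => if_neg (hc0 j)), one_mul, prod_eq_single s] at this
    · simp at this
    · intro s' _ hs'
      have : s' = s₁ ∨ s' = s₂ := by omega
      rcases this with rfl | rfl
      · exact if_neg (Ne.symm hc1)
      · exact if_neg (Ne.symm hc2)
    · simp
  have hpair : ∀ s s₁ s₂ : Fin 3, s₁ ≠ s → s₂ ≠ s → s₁ ≠ s₂ → b' s₁ = b' s₂ → ∃ j, b j = b' s := by
    intro s s₁ s₂ h1 h2 h3 heq
    by_contra! hc0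
    have := hδ (b' s)
    simp only [signChar, MonoidHom.coe_mk, OneHom.coe_mk] at this
    rw [prod_eq_one (fun j _ => if_neg (hc0 j)), one_mul] at this
    have huniv : (univ : Finset (Fin 3)) = {s, s₁, s₂} := by
      ext x; simp; omega
    rw [huniv, prod_insert (by simp [Ne.symm h1, Ne.symm h2]), prod_insert (by simp [h3]),
      prod_singleton, heq, if_pos rfl] at this
    split_ifs at this <;> simp at this
  have hupd : ∀ s s₁ s₂ : Fin 3, s₁ ≠ s → s₂ ≠ s → s₁ ≠ s₂ → b' s₁ = b' s₂ → b' ∈ pairable b B := by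
    intro s s₁ s₂ h1 h2 h3 heq
    obtain ⟨j, hj⟩ := hpair s s₁ s₂ h1 h2 h3 heq
    refine mem_union_right _ (mem_image.mpr ⟨(s, j, b' s₁), by simp [hb'], ?_⟩)
    funext x
    by_cases hx : x = s
    · subst hx; simp [hj]
    · have : x = s₁ ∨ x = s₂ := by omega
      rcases this with rfl | rfl
      · simp [hx]
      · simp [hx, heq]
  by_cases h01 : b' 0 = b' 1
  · exact hupd 2 0 1 (by decide) (by decide) (by decide) h01
  by_cases h02 : b' 0 = b' 2
  · exact hupd 1 0 2 (by decide) (by decide) (by decide) h02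
  by_cases h12 : b' 1 = b' 2
  · exact hupd 0 1 2 (by decide) (by decide) (by decide) h12
  have hall : ∀ s, ∃ j, b j = b' s := by
    intro s
    fin_cases s
    · rcases hrange 0 1 2 (by decide) (by decide) (by decide) with h | h | h
      exacts [h, absurd h h01, absurd h h02]
    · rcases hrange 1 0 2 (by decide) (by decide) (by decide) with h | h | h
      exacts [h, absurd h.symm h01, absurd h h12]
    · rcases hrange 2 0 1 (by decide) (by decide) (by decide) with h | h | h
      exacts [h, absurd h.symm h02, absurd h.symm h12]
  choose σ hσ using hall
  exact mem_union_left _ (mem_image.mpr ⟨σ, mem_univ _, funext hσ⟩)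

/-- A cubic Rademacher chaos on a set of size `K` has second moment at most `36 K` times the squared
norm of its coefficients. -/
theorem sum_norm_sq_chaos_le (B : Finset ι) (A : (Fin 3 → ι) → ℂ) :
    ∑ ε : ι → ℤˣ, ‖∑ b ∈ Fintype.piFinset fun _ => B, (((∏ s, ε (b s) : ℤˣ) : ℤ) : ℂ) * A b‖ ^ 2
      ≤ 2 ^ Fintype.card ι * (36 * #B * ∑ b ∈ Fintype.piFinset fun _ => B, ‖A b‖ ^ 2) := by
  set S : Finset (Fin 3 → ι) := Fintype.piFinset fun _ => B with hS
  let M : (Fin 3 → ι) → (Fin 3 → ι) → ℝ := fun b b' => ∑ ε, ((signChar b b' ε : ℤ) : ℝ)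
  have hMsymm : ∀ b b', M b b' = M b' b := fun b b' =>
    sum_congr rfl fun ε _ => by rw [signChar_comm]
  -- Schur test: a row of `M` has at most `36 * #B` nonzero entries, each of absolute value at most
  -- the number of sign vectors.
  have hrow : ∀ b ∈ S, ∑ b' ∈ S, |M b b'| ≤ 2 ^ Fintype.card ι * (36 * #B) := by
    intro b hb
    have hbB := Fintype.mem_piFinset.mp hb
    calc ∑ b' ∈ S, |M b b'| = ∑ b' ∈ S with M b b' ≠ 0, |M b b'| := by
          rw [sum_filter]
          refine sum_congr rfl fun b' _ => ?_
          split_ifs with h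
          · rfl
          · rw [not_not.mp h, abs_zero]
      _ ≤ ∑ b' ∈ S with M b b' ≠ 0, (2 : ℝ) ^ Fintype.card ι :=
          sum_le_sum fun b' _ => abs_sum_signChar_le b b'
      _ = #{b' ∈ S | M b b' ≠ 0} * (2 : ℝ) ^ Fintype.card ι := by rw [sum_const, nsmul_eq_mul]
      _ ≤ (36 * #B) * (2 : ℝ) ^ Fintype.card ι := by
          gcongr
          have h1 : #{b' ∈ S | M b b' ≠ 0} ≤ #(pairable b B) := by
            refine card_le_card fun b' hb' => ?_
            rw [mem_filter] at hb'
            exact mem_pairable_of_sum_ne_zero (Fintype.mem_piFinset.mp hb'.1) hb'.2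
          exact_mod_cast h1.trans (card_pairable_le (card_pos.mpr ⟨_, hbB 0⟩))
      _ = _ := by ring
  have hexp : ((∑ ε : ι → ℤˣ, ‖∑ b ∈ S, (((∏ s, ε (b s) : ℤˣ) : ℤ) : ℂ) * A b‖ ^ 2 : ℝ) : ℂ)
      = ∑ b ∈ S, ∑ b' ∈ S, (M b b' : ℂ) * ((starRingEnd ℂ) (A b) * A b') := by
    push_cast
    simp_rw [← Complex.conj_mul', map_sum, sum_mul_sum]
    rw [sum_comm]
    refine sum_congr rfl fun b _ => ?_
    rw [sum_comm]
    refine sum_congr rfl fun b' _ => ?_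
    simp only [M]
    push_cast
    rw [sum_mul]
    refine sum_congr rfl fun ε _ => ?_
    simp only [signChar, MonoidHom.coe_mk, OneHom.coe_mk, map_mul, Units.val_mul, Int.cast_mul,
      map_intCast, map_prod, Units.coe_prod, Int.cast_prod]
    ring
  have hnn : 0 ≤ ∑ ε : ι → ℤˣ, ‖∑ b ∈ S, (((∏ s, ε (b s) : ℤˣ) : ℤ) : ℂ) * A b‖ ^ 2 :=
    sum_nonneg fun _ _ => sq_nonneg _
  calc _ = ‖((∑ ε : ι → ℤˣ, ‖∑ b ∈ S, (((∏ s, ε (b s) : ℤˣ) : ℤ) : ℂ) * A b‖ ^ 2 : ℝ) : ℂ)‖ := by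
        rw [Complex.norm_real, Real.norm_of_nonneg hnn]
    -- By `2xy ≤ x² + y²` and the symmetry of `M`, the quadratic form is controlled by the row sums.
    _ ≤ ∑ b ∈ S, ∑ b' ∈ S, |M b b'| * (‖A b‖ ^ 2 / 2 + ‖A b'‖ ^ 2 / 2) := by
        rw [hexp]
        refine (norm_sum_le _ _).trans (sum_le_sum fun b _ => ?_)
        refine (norm_sum_le _ _).trans (sum_le_sum fun b' _ => ?_)
        rw [norm_mul, norm_mul, Complex.norm_real, Real.norm_eq_abs, RCLike.norm_conj]
        gcongr
        nlinarith [sq_nonneg (‖A b‖ - ‖A b'‖)]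
    _ = ∑ b ∈ S, (∑ b' ∈ S, |M b b'|) * ‖A b‖ ^ 2 := by
        simp_rw [mul_add, sum_add_distrib]
        have h2 : ∑ b ∈ S, ∑ b' ∈ S, |M b b'| * (‖A b'‖ ^ 2 / 2)
            = ∑ b ∈ S, ∑ b' ∈ S, |M b b'| * (‖A b‖ ^ 2 / 2) := by
          rw [sum_comm]
          exact sum_congr rfl fun b _ => sum_congr rfl fun b' _ => by rw [hMsymm]
        rw [h2, ← sum_add_distrib]
        refine sum_congr rfl fun b _ => ?_
        rw [← sum_mul]
        ring
    _ ≤ ∑ b ∈ S, (2 ^ Fintype.card ι * (36 * #B)) * ‖A b‖ ^ 2 := by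
        gcongr with b hb
        exact hrow b hb
    _ = _ := by rw [← mul_sum]; ring

end Signs

namespace BlackBoxMoney

/-! ### Averaging over rotations inside degenerate eigenspaces -/

section Averaging

open Finset

variable {t N r m : ℕ}

instance (N : ℕ) : SecondCountableTopology (Matrix.orthogonalGroup (Fin N) ℝ) := by
  have : SecondCountableTopology (Matrix (Fin N) (Fin N) ℝ) :=
    inferInstanceAs (SecondCountableTopology (Fin N → Fin N → ℝ))
  exact TopologicalSpace.Subtype.secondCountableTopology _

instance (N : ℕ) : IsProbabilityMeasure (haarOrthogonal N) := ⟨Measure.haarMeasure_self⟩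

instance (N : ℕ) : (haarOrthogonal N).IsHaarMeasure :=
  inferInstanceAs (Measure.haarMeasure ⊤).IsHaarMeasure

/-- A right translate of a Haar probability measure is again one, and such a measure is unique.
Right invariance is needed because rotating the basis vectors multiplies `O` on the right. -/
instance (N : ℕ) : (haarOrthogonal N).IsMulRightInvariant := by
  refine ⟨fun g => ?_⟩
  have : IsProbabilityMeasure ((haarOrthogonal N).map (· * g)) :=
    Measure.isProbabilityMeasure_map (by fun_prop)
  exact Measure.isHaarMeasure_eq_of_isProbabilityMeasure _ _

/-- The diagonal matrix of a choice of signs. -/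
def signMatrix (ε : Fin N → ℤˣ) : Matrix.orthogonalGroup (Fin N) ℝ :=
  ⟨Matrix.diagonal fun i => ((ε i : ℤ) : ℝ), by
    rw [Matrix.mem_orthogonalGroup_iff, Matrix.diagonal_transpose, Matrix.diagonal_mul_diagonal, ← Matrix.diagonal_one]
    congr 1
    funext i
    rcases Int.units_eq_one_or (ε i) with h | h <;> simp [h]⟩

theorem signMatrix_mul_apply (ε : Fin N → ℤˣ) (H : Matrix.orthogonalGroup (Fin N) ℝ)
    (a b : Fin N) : (signMatrix ε * H).1 a b = ((ε a : ℤ) : ℝ) * H.1 a b :=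
  Matrix.diagonal_mul _ _ _ _

variable {β : Type*} [DecidableEq β]

/-- For a column in a block of size `K`, the rotated coefficient is a cubic chaos over triples in
that block. The chaos bound `36K` times the flatness bound `(2/K)³` gives `288/K²`. A triple is met
by at most the `K` columns of its own block, leaving `288/K ≤ 288/L`, and Parseval sums over all
triples. -/
theorem sum_sign_tripleWeight_le {f : Fin N → β} {L : ℝ} (hL : 0 < L)
    (hf : ∀ a, L ≤ #(univ.filter (f · = f a))) {H : Matrix.orthogonalGroup (Fin N) ℝ}
    (hH0 : ∀ a b, f a ≠ f b → H.1 a b = 0)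
    (hH : ∀ a b, H.1 a b ^ 2 ≤ 2 / #(univ.filter (f · = f b)))
    (O : Matrix.orthogonalGroup (Fin N) ℝ) (Φ : State N r m) :
    ∑ ε : Fin N → ℤˣ, tripleWeight (O * (signMatrix ε * H)).1 Φ
      ≤ 2 ^ N * (288 / L * ‖Φ‖ ^ 2) := by
  let B : Fin N → Finset (Fin N) := fun i => univ.filter (f · = f i)
  let S : Fin N → Finset (Fin 3 → Fin N) := fun i => Fintype.piFinset fun _ => B i
  have hBpos : ∀ i, (0 : ℝ) < #(B i) := fun i => hL.trans_le (hf i)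
  have hcoeff : ∀ (ε : Fin N → ℤˣ) i y, coeff (O * (signMatrix ε * H)).1 Φ (fun _ => i) y
      = ∑ b ∈ S i, (((∏ s, ε (b s) : ℤˣ) : ℤ) : ℂ) *
          (((∏ s, H.1 (b s) i : ℝ) : ℂ) * coeff O.1 Φ b y) := by
    intro ε i y
    change coeff (O.1 * (signMatrix ε * H).1) Φ (fun _ => i) y = _
    rw [coeff_mul]
    refine (sum_subset (subset_univ (S i)) fun b _ hb => ?_).symm.trans (sum_congr rfl fun b _ => ?_)
    · have : ∃ s, b s ∉ B i := by
        by_contra! h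
        exact hb (Fintype.mem_piFinset.mpr h)
      obtain ⟨s, hs⟩ := this
      rw [prod_eq_zero (mem_univ s), Complex.ofReal_zero, zero_mul]
      rw [signMatrix_mul_apply, hH0 _ _ (by simpa [B] using hs), mul_zero]
    · simp_rw [signMatrix_mul_apply, prod_mul_distrib]
      push_cast
      ring
  have hterm : ∀ i y, ∑ ε : Fin N → ℤˣ, ‖coeff (O * (signMatrix ε * H)).1 Φ (fun _ => i) y‖ ^ 2
      ≤ 2 ^ N * ∑ b ∈ S i, 288 / (#(B i) : ℝ) ^ 2 * ‖coeff O.1 Φ b y‖ ^ 2 := by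
    intro i y
    simp_rw [hcoeff]
    refine (sum_norm_sq_chaos_le (B i) _).trans ?_
    rw [Fintype.card_fin, mul_sum]
    refine mul_le_mul_of_nonneg_left (sum_le_sum fun b hb => ?_) (by positivity)
    have hk := hBpos i
    have hprod : (∏ s, H.1 (b s) i) ^ 2 ≤ (2 / #(B i)) ^ 3 := by
      rw [← prod_pow]
      refine (prod_le_prod (fun s _ => sq_nonneg _) fun s _ => hH (b s) i).trans ?_
      simp [B, div_pow]
    rw [norm_mul, mul_pow, Complex.norm_real, Real.norm_eq_abs, sq_abs]
    calc 36 * (#(B i) : ℝ) * ((∏ s, H.1 (b s) i) ^ 2 * ‖coeff O.1 Φ b y‖ ^ 2)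
        ≤ 36 * (#(B i) : ℝ) * ((2 / #(B i)) ^ 3 * ‖coeff O.1 Φ b y‖ ^ 2) := by gcongr
      _ = _ := by field_simp; ring
  have hcount : ∀ b : Fin 3 → Fin N, ∑ i, (if b ∈ S i then 288 / (#(B i) : ℝ) ^ 2 else 0)
      ≤ 288 / L := by
    intro b
    have hsub : ∀ i, b ∈ S i → i ∈ B (b 0) ∧ #(B i) = #(B (b 0)) := by
      intro i hi
      have : f (b 0) = f i := (mem_filter.mp (Fintype.mem_piFinset.mp hi 0)).2
      exact ⟨mem_filter.mpr ⟨mem_univ _, this.symm⟩, by simp only [B, this]⟩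
    have hk := hBpos (b 0)
    calc ∑ i, (if b ∈ S i then 288 / (#(B i) : ℝ) ^ 2 else 0)
        ≤ ∑ i, (if i ∈ B (b 0) then 288 / (#(B (b 0)) : ℝ) ^ 2 else 0) := by
          refine sum_le_sum fun i _ => ?_
          by_cases hi : b ∈ S i
          · rw [if_pos hi, if_pos (hsub i hi).1, (hsub i hi).2]
          · rw [if_neg hi]
            split_ifs <;> positivity
      _ = 288 / (#(B (b 0)) : ℝ) := by
          rw [sum_ite_mem, univ_inter, sum_const, nsmul_eq_mul]
          field_simp
      _ ≤ 288 / L := by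
          gcongr
          exact hf (b 0)
  calc ∑ ε : Fin N → ℤˣ, tripleWeight (O * (signMatrix ε * H)).1 Φ
      = ∑ i, ∑ y, ∑ ε : Fin N → ℤˣ, ‖coeff (O * (signMatrix ε * H)).1 Φ (fun _ => i) y‖ ^ 2 := by
        simp_rw [tripleWeight]
        rw [sum_comm]
        exact sum_congr rfl fun i _ => sum_comm
    _ ≤ ∑ i, ∑ y, 2 ^ N * ∑ b ∈ S i, 288 / (#(B i) : ℝ) ^ 2 * ‖coeff O.1 Φ b y‖ ^ 2 :=
        sum_le_sum fun i _ => sum_le_sum fun y _ => hterm i y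
    _ = 2 ^ N * ∑ b, (∑ i, if b ∈ S i then 288 / (#(B i) : ℝ) ^ 2 else 0) *
          ∑ y, ‖coeff O.1 Φ b y‖ ^ 2 := by
        simp_rw [← mul_sum, sum_mul]
        congr 1
        rw [sum_comm (s := (univ : Finset (Fin 3 → Fin N)))]
        refine sum_congr rfl fun i _ => ?_
        simp_rw [ite_mul, zero_mul]
        rw [sum_ite_mem, univ_inter, sum_comm, mul_sum]
    _ ≤ 2 ^ N * ∑ b, 288 / L * ∑ y, ‖coeff O.1 Φ b y‖ ^ 2 := by
        gcongr with b
        exact hcount b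
    _ = 2 ^ N * (288 / L * ‖Φ‖ ^ 2) := by
        rw [← mul_sum, sum_norm_sq_coeff O Φ]

theorem continuous_tripleWeight_left [NeZero N] (C : Circuit t N r m)
    (z : Fin N → Fin t → Circle) :
    Continuous fun O : Matrix.orthogonalGroup (Fin N) ℝ =>
      tripleWeight O.1 (C.output (operators O z)) :=
  (continuous_tripleWeight C).comp (f := fun O => (O, z)) (by fun_prop)

theorem integrable_of_continuous_orthogonal {g : Matrix.orthogonalGroup (Fin N) ℝ → ℝ}
    (hg : Continuous g) : Integrable g (haarOrthogonal N) := by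
  have := hg.continuousOn.integrableOn_compact (μ := haarOrthogonal N)
    (isCompact_univ (X := Matrix.orthogonalGroup (Fin N) ℝ))
  rwa [integrableOn_univ] at this

/-- If the eigenvalue vectors take each of their values many times, then a triple eigenstate of a
random basis is rarely produced. -/
theorem integral_tripleWeight_le_of_blocks [NeZero N] (C : Circuit t N r m) {f : Fin N → β}
    {z : Fin N → Fin t → Circle} (hz : ∀ a b, f a = f b → z a = z b) {L : ℝ} (hL : 0 < L)
    (hf : ∀ a, L ≤ #(univ.filter (f · = f a))) :
    ∫ O, tripleWeight O.1 (C.output (operators O z)) ∂(haarOrthogonal N) ≤ 288 / L := by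
  obtain ⟨H, hH0, hH⟩ := exists_flat_block_orthogonal f
  set F : Matrix.orthogonalGroup (Fin N) ℝ → ℝ := fun O =>
    tripleWeight O.1 (C.output (operators O z)) with hF
  have hc : Continuous F := continuous_tripleWeight_left C z
  -- The rotation stays inside the blocks, so the output state does not move while the basis in
  -- which it is measured does.
  have hinv : ∀ (ε : Fin N → ℤˣ) O, F (O * (signMatrix ε * H))
      = tripleWeight (O * (signMatrix ε * H)).1 (C.output (operators O z)) := by
    intro ε O
    simp only [hF]
    rw [operators_mul_of_block]
    intro a b hab
    refine hz a b ?_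
    by_contra hne
    rw [signMatrix_mul_apply, hH0 a b hne, mul_zero] at hab
    exact hab rfl
  have hsum : (2 : ℝ) ^ N * ∫ O, F O ∂(haarOrthogonal N)
      = ∫ O, ∑ ε : Fin N → ℤˣ, F (O * (signMatrix ε * H)) ∂(haarOrthogonal N) := by
    rw [integral_finsetSum _ fun ε _ => integrable_of_continuous_orthogonal (by fun_prop)]
    simp_rw [integral_mul_right_eq_self F]
    simp
  have hle : ∫ O, ∑ ε : Fin N → ℤˣ, F (O * (signMatrix ε * H)) ∂(haarOrthogonal N)
      ≤ ∫ _, (2 : ℝ) ^ N * (288 / L) ∂(haarOrthogonal N) := by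
    refine integral_mono (integrable_of_continuous_orthogonal (by fun_prop)) (integrable_const _)
      fun O => ?_
    simp only [hinv]
    refine (sum_sign_tripleWeight_le hL hf hH0 hH O _).trans ?_
    rw [norm_output C fun j => operators_mem_unitaryGroup O z j]
    simp
  rw [← hsum, integral_const, probReal_univ, one_smul] at hle
  exact le_of_mul_le_mul_left hle (by positivity)

end Averaging

end BlackBoxMoney

/-! ### Random colourings have no sparse colour -/

section Colourings

open Finset

/-- Chernoff bound with parameter `2`. The exponential moment of the class size is `(1 - (1 -
e⁻²)/r)^N ≤ exp(-3N/(4r))`, using `e⁻² ≤ 1/4`; the threshold `N/(8r)` costs a factor `exp(N/(4r))`.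
-/
theorem card_sparse_colour_le {N r : ℕ} (hr : 0 < r) (b : Fin r) :
    (#{f : Fin N → Fin r | (#(univ.filter (f · = b)) : ℝ) < N / (8 * r)} : ℝ)
      ≤ (r : ℝ) ^ N * Real.exp (-(N / (2 * r))) := by
  have hr' : (1 : ℝ) ≤ r := by exact_mod_cast hr
  set bad : Finset (Fin N → Fin r) :=
    univ.filter fun f => (#(univ.filter (f · = b)) : ℝ) < N / (8 * r) with hbad
  have hgen : ∑ f : Fin N → Fin r, Real.exp (-2 * #(univ.filter (f · = b)))
      = (r - (1 - Real.exp (-2))) ^ N := by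
    have h1 : ∀ f : Fin N → Fin r, Real.exp (-2 * #(univ.filter (f · = b)))
        = ∏ i, if f i = b then Real.exp (-2) else 1 := by
      intro f
      rw [prod_ite, prod_const, prod_const_one, mul_one, mul_comm, Real.exp_nat_mul]
    simp_rw [h1]
    have h2 := (prod_univ_sum (fun _ : Fin N => (univ : Finset (Fin r)))
      fun _ c => if c = b then Real.exp (-2) else (1 : ℝ)).symm
    rw [Fintype.piFinset_univ] at h2
    rw [h2, prod_const, card_univ, Fintype.card_fin]
    congr 1
    rw [sum_ite, sum_const, sum_const, filter_eq', if_pos (mem_univ b), filter_ne',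
      card_erase_of_mem (mem_univ b)]
    simp only [card_singleton, card_univ, Fintype.card_fin, one_smul, nsmul_eq_mul, mul_one]
    rw [Nat.cast_sub hr]
    push_cast
    ring
  have hexp2 : Real.exp (-2) ≤ 1 / 4 := by
    rw [Real.exp_neg, inv_le_comm₀ (Real.exp_pos _) (by norm_num)]
    have h := Real.add_one_le_exp (1 : ℝ)
    have : Real.exp 2 = Real.exp 1 * Real.exp 1 := by rw [← Real.exp_add]; norm_num
    rw [this]
    nlinarith
  have hlow : (#bad : ℝ) * Real.exp (-(N / (4 * r))) ≤ (r - (1 - Real.exp (-2))) ^ N := by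
    rw [← hgen, ← nsmul_eq_mul, ← sum_const]
    refine (sum_le_sum fun f hf => ?_).trans
      (sum_le_sum_of_subset_of_nonneg (subset_univ bad) fun _ _ _ => (Real.exp_pos _).le)
    rw [Real.exp_le_exp]
    have := (mem_filter.mp hf).2
    have e : (N : ℝ) / (4 * r) = 2 * (N / (8 * r)) := by field_simp; ring
    rw [e]
    linarith
  have hup : (r - (1 - Real.exp (-2))) ^ N ≤ (r : ℝ) ^ N * Real.exp (-(3 * N / (4 * r))) := by
    have h1 : (r : ℝ) - (1 - Real.exp (-2)) ≤ r * Real.exp (-(3 / (4 * r))) := by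
      have h2 := Real.add_one_le_exp (-(3 / (4 * (r : ℝ))))
      have h3 : (r : ℝ) * (-(3 / (4 * r)) + 1) = r - 3 / 4 := by field_simp; ring
      nlinarith
    have h0 : 0 ≤ (r : ℝ) - (1 - Real.exp (-2)) := by linarith [Real.exp_pos (-2)]
    calc _ ≤ ((r : ℝ) * Real.exp (-(3 / (4 * r)))) ^ N := pow_le_pow_left₀ h0 h1 N
      _ = _ := by
        rw [mul_pow, ← Real.exp_nat_mul]
        congr 2
        ring
  have hpos := Real.exp_pos (-(N / (4 * r) : ℝ))
  rw [← mul_le_mul_iff_left₀ hpos]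
  refine (hlow.trans hup).trans (le_of_eq ?_)
  rw [mul_assoc, ← Real.exp_add]
  congr 2
  field_simp
  ring

/-- Union bound over the `r` colours: the assumption on `r` makes each Chernoff term at most `1/N`.
-/
theorem card_unbalanced_le {N r : ℕ} (hr : 0 < r) (hN : 0 < N)
    (h : 2 * r * Real.log N ≤ N) :
    (#{f : Fin N → Fin r | ∃ b, (#(univ.filter (f · = b)) : ℝ) < N / (8 * r)} : ℝ)
      ≤ (r : ℝ) ^ N * (r / N) := by
  have hr' : (0 : ℝ) < r := by exact_mod_cast hr
  have hN' : (0 : ℝ) < N := by exact_mod_cast hN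
  have hexp : Real.exp (-(N / (2 * r) : ℝ)) ≤ 1 / N := by
    rw [one_div, ← Real.exp_log hN', ← Real.exp_neg, Real.exp_log hN', Real.exp_le_exp, neg_le_neg_iff,
      le_div_iff₀ (by positivity)]
    linarith
  have hsub : (univ.filter fun f : Fin N → Fin r =>
      ∃ b, (#(univ.filter (f · = b)) : ℝ) < N / (8 * r))
      ⊆ univ.biUnion fun b => univ.filter fun f : Fin N → Fin r =>
        (#(univ.filter (f · = b)) : ℝ) < N / (8 * r) := by
    intro f hf
    obtain ⟨b, hb⟩ := (mem_filter.mp hf).2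
    exact mem_biUnion.mpr ⟨b, mem_univ _, mem_filter.mpr ⟨mem_univ _, hb⟩⟩
  calc _ ≤ ((∑ b : Fin r, #{f : Fin N → Fin r |
          (#(univ.filter (f · = b)) : ℝ) < N / (8 * r)} : ℕ) : ℝ) := by
        exact_mod_cast (card_le_card hsub).trans card_biUnion_le
    _ ≤ ∑ b : Fin r, (r : ℝ) ^ N * (1 / N) := by
        push_cast
        refine sum_le_sum fun b _ => (card_sparse_colour_le hr b).trans ?_
        gcongr
    _ = _ := by
        rw [sum_const, card_univ, Fintype.card_fin, nsmul_eq_mul]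
        ring

end Colourings

namespace BlackBoxMoney

/-! ### The expected weight: repeated means and interpolation -/

section Expectation

open Finset

variable {t N r m : ℕ}

theorem integrable_of_continuous_prod (D : Measure (Fin t → Circle)) [IsProbabilityMeasure D]
    {κ : Type*} [Fintype κ]
    {g : Matrix.orthogonalGroup (Fin N) ℝ × (κ → Fin t → Circle) → ℝ} (hg : Continuous g) :
    Integrable g ((haarOrthogonal N).prod (Measure.pi fun _ => D)) := by
  have := hg.continuousOn.integrableOn_compact
    (μ := (haarOrthogonal N).prod (Measure.pi fun _ : κ => D))
    (isCompact_univ (X := Matrix.orthogonalGroup (Fin N) ℝ × (κ → Fin t → Circle)))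
  rwa [integrableOn_univ] at this

/-- The mean success weight when the eigenvalue vectors are drawn from `k` samples. -/
noncomputable def repeatedMean [NeZero N] (D : Measure (Fin t → Circle)) (C : Circuit t N r m) (k : ℕ)
    (O : Matrix.orthogonalGroup (Fin N) ℝ) : ℝ :=
  ((k : ℝ) ^ N)⁻¹ * ∑ f : Fin N → Fin k, ∫ w : Fin k → Fin t → Circle,
    tripleWeight O.1 (C.output (operators O (w ∘ f))) ∂(Measure.pi fun _ => D)

variable [NeZero N]

theorem tripleWeight_output_le_one (C : Circuit t N r m) (O : Matrix.orthogonalGroup (Fin N) ℝ)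
    (z : Fin N → Fin t → Circle) : tripleWeight O.1 (C.output (operators O z)) ≤ 1 := by
  refine (tripleWeight_le O _).trans ?_
  rw [norm_output C fun j => operators_mem_unitaryGroup O z j, one_pow]

theorem continuous_tripleWeight_comp (C : Circuit t N r m) {k : ℕ} (f : Fin N → Fin k) :
    Continuous fun ω : Matrix.orthogonalGroup (Fin N) ℝ × (Fin k → Fin t → Circle) =>
      tripleWeight ω.1.1 (C.output (operators ω.1 (ω.2 ∘ f))) := by
  have hf : Continuous fun ω : Matrix.orthogonalGroup (Fin N) ℝ × (Fin k → Fin t → Circle) =>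
      (ω.1, ω.2 ∘ f) :=
    continuous_fst.prodMk (continuous_pi fun i => (continuous_apply (f i)).comp continuous_snd)
  have h := (continuous_tripleWeight C).comp hf
  simpa only [Function.comp_def] using h

theorem integral_tripleWeight_eq (D : Measure (Fin t → Circle)) [IsProbabilityMeasure D]
    (C : Circuit t N r m) {n : ℕ} (hn : 1 ≤ n) (hq : C.queries + C.queries ≤ n)
    (O : Matrix.orthogonalGroup (Fin N) ℝ) :
    ∫ z, tripleWeight O.1 (C.output (operators O z)) ∂(Measure.pi fun _ => D)
      = ∑ j ∈ Icc 1 n, (nodeWeight n j).re * repeatedMean D C (node n j) O := by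
  have h := integral_eq_sum_identifiedMean D hn hq (tripleWeight_mem_junta C O)
  have hid : ∀ k : ℕ, identifiedMean D k (fun z : Fin N → Fin t → Circle =>
      (tripleWeight O.1 (C.output (operators O z)) : ℂ)) = (repeatedMean D C k O : ℂ) := by
    intro k
    rw [identifiedMean, repeatedMean]
    simp_rw [integral_complex_ofReal]
    push_cast
    rw [Fintype.card_fin]
  simp_rw [hid] at h
  rw [integral_complex_ofReal] at h
  have h' := congrArg Complex.re h
  rw [Complex.ofReal_re, Complex.re_sum] at h'
  rw [h']
  exact sum_congr rfl fun j _ => Complex.re_mul_ofReal _ _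

theorem integrable_repeatedMean (D : Measure (Fin t → Circle)) [IsProbabilityMeasure D]
    (C : Circuit t N r m) (k : ℕ) : Integrable (repeatedMean D C k) (haarOrthogonal N) :=
  (integrable_finsetSum _ fun f _ =>
    (integrable_of_continuous_prod D (continuous_tripleWeight_comp C f)).integral_prod_left).const_mul _

theorem integral_repeatedMean_nonneg (D : Measure (Fin t → Circle)) (C : Circuit t N r m) (k : ℕ) :
    0 ≤ ∫ O, repeatedMean D C k O ∂(haarOrthogonal N) :=
  integral_nonneg fun O => mul_nonneg (by positivity) (sum_nonneg fun f _ =>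
    integral_nonneg fun w => tripleWeight_nonneg _ _)

/-- Fubini lets the basis be averaged first, with the colouring and the samples fixed. Balanced
colourings contribute `288/(N/(8k)) = 2304 k/N`, and unbalanced ones at most their probability
`k/N`. -/
theorem integral_repeatedMean_le (D : Measure (Fin t → Circle)) [IsProbabilityMeasure D]
    (C : Circuit t N r m) {k : ℕ} (hk : 0 < k) (h : 2 * k * Real.log N ≤ N) :
    ∫ O, repeatedMean D C k O ∂(haarOrthogonal N) ≤ 2305 * (k / N) := by
  have hN : 0 < N := Nat.pos_of_ne_zero (NeZero.ne N)
  have hN' : (0 : ℝ) < N := by exact_mod_cast hN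
  have hk' : (0 : ℝ) < k := by exact_mod_cast hk
  have hL : (0 : ℝ) < N / (8 * k) := by positivity
  let I : (Fin N → Fin k) → ℝ := fun f => ∫ w : Fin k → Fin t → Circle,
    ∫ O, tripleWeight O.1 (C.output (operators O (w ∘ f))) ∂(haarOrthogonal N)
      ∂(Measure.pi fun _ => D)
  have hmono : ∀ (f : Fin N → Fin k) (c : ℝ), (∀ w : Fin k → Fin t → Circle,
      ∫ O, tripleWeight O.1 (C.output (operators O (w ∘ f))) ∂(haarOrthogonal N) ≤ c) →
      I f ≤ c := by
    intro f c hc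
    have h1 : I f ≤ ∫ _ : Fin k → Fin t → Circle, c ∂(Measure.pi fun _ => D) :=
      integral_mono (integrable_of_continuous_prod D
        (continuous_tripleWeight_comp C f)).integral_prod_right (integrable_const _) hc
    simpa using h1
  have hone : ∀ f, I f ≤ 1 := fun f => hmono f 1 fun w => by
    have h1 : ∫ O, tripleWeight O.1 (C.output (operators O (w ∘ f))) ∂(haarOrthogonal N)
        ≤ ∫ _, (1 : ℝ) ∂(haarOrthogonal N) :=
      integral_mono (integrable_of_continuous_orthogonal (continuous_tripleWeight_left C _))
        (integrable_const _) fun O => tripleWeight_output_le_one C O _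
    simpa using h1
  have hgood : ∀ f : Fin N → Fin k,
      (¬ ∃ b, (#(univ.filter (f · = b)) : ℝ) < N / (8 * k)) → I f ≤ 288 / (N / (8 * k)) := by
    intro f hf
    push Not at hf
    exact hmono f _ fun w => integral_tripleWeight_le_of_blocks C (f := f)
      (fun a b hab => congrArg w hab) hL fun a => hf (f a)
  have heq : ∫ O, repeatedMean D C k O ∂(haarOrthogonal N) = ((k : ℝ) ^ N)⁻¹ * ∑ f, I f := by
    unfold repeatedMean
    rw [integral_const_mul, integral_finsetSum _ fun f _ => (integrable_of_continuous_prod D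
      (continuous_tripleWeight_comp C f)).integral_prod_left]
    congr 1
    exact sum_congr rfl fun f _ => integral_integral_swap
      (integrable_of_continuous_prod D (continuous_tripleWeight_comp C f))
  have hpt : ∀ f, I f ≤ (if ∃ b, (#(univ.filter (f · = b)) : ℝ) < N / (8 * k) then 1 else 0)
      + 288 / (N / (8 * k)) := by
    intro f
    split_ifs with hf
    · have : (0 : ℝ) ≤ 288 / (N / (8 * k)) := by positivity
      linarith [hone f]
    · linarith [hgood f hf]
  rw [heq]
  calc ((k : ℝ) ^ N)⁻¹ * ∑ f, I f
      ≤ ((k : ℝ) ^ N)⁻¹ * ((k : ℝ) ^ N * (k / N) + (k : ℝ) ^ N * (288 / (N / (8 * k)))) := by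
        gcongr
        refine (sum_le_sum fun f _ => hpt f).trans ?_
        rw [sum_add_distrib, sum_boole, sum_const, card_univ, Fintype.card_fun, Fintype.card_fin,
          Fintype.card_fin, nsmul_eq_mul]
        push_cast
        gcongr
        exact card_unbalanced_le hk hN h
    _ = 2305 * (k / N) := by field_simp; norm_num

theorem integral_tripleWeight_le (D : Measure (Fin t → Circle)) [IsProbabilityMeasure D]
    (C : Circuit t N r m) {d : ℕ} (hd : 2 ≤ d) (hq : C.queries ≤ d)
    (hdN : (d : ℝ) ^ 3 < (N : ℝ) / (16 * Real.log N)) :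
    ∫ O, ∫ z, tripleWeight O.1 (C.output (operators O z)) ∂(Measure.pi fun _ => D)
        ∂(haarOrthogonal N)
      ≤ 147520 * Real.exp 20 * ((d : ℝ) ^ 3 * Real.log d / N) := by
  have hN' : (0 : ℝ) < N := by exact_mod_cast Nat.pos_of_ne_zero (NeZero.ne N)
  have hd' : (2 : ℝ) ≤ d := by exact_mod_cast hd
  -- For `N = 1` the division by `log N = 0` makes the right side of `hdN` zero, contradicting
  -- `hdN`.
  have hlogN : 0 < Real.log N := by
    rcases (Real.log_natCast_nonneg N).lt_or_eq with h | h
    · exact h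
    · rw [← h, mul_zero, div_zero] at hdN
      exact absurd hdN (not_lt.mpr (by positivity))
  rw [lt_div_iff₀ (by positivity)] at hdN
  have hnode : ∀ j ∈ Icc 1 (2 * d),
      ∫ O, repeatedMean D C (node (2 * d) j) O ∂(haarOrthogonal N)
        ≤ 2305 * (node (2 * d) j / N) := by
    intro j hj
    rw [mem_Icc] at hj
    refine integral_repeatedMean_le D C (node_pos hj.1 hj.2) ?_
    have h1 : (node (2 * d) j : ℝ) ≤ 8 * (d : ℝ) ^ 3 := by
      have : (node (2 * d) j : ℝ) ≤ ((2 * d : ℕ) : ℝ) ^ 3 := by exact_mod_cast node_le_cube _ _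
      refine this.trans (le_of_eq ?_)
      push_cast; ring
    nlinarith
  -- The only use of `2 ≤ d` beyond positivity: it inserts `log d` into a bound of order `d³/N`, at
  -- the price of doubling the constant `2305 * 4 * 8 * exp 20`.
  have hlogd : 1 / 2 ≤ Real.log d :=
    le_trans (by linarith [Real.log_two_gt_d9]) (Real.log_le_log two_pos hd')
  calc ∫ O, ∫ z, tripleWeight O.1 (C.output (operators O z)) ∂(Measure.pi fun _ => D)
        ∂(haarOrthogonal N)
      = ∑ j ∈ Icc 1 (2 * d), (nodeWeight (2 * d) j).re *
          ∫ O, repeatedMean D C (node (2 * d) j) O ∂(haarOrthogonal N) := by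
        simp_rw [integral_tripleWeight_eq D C (n := 2 * d) (by omega) (by omega)]
        rw [integral_finsetSum _ fun j _ => (integrable_repeatedMean D C _).const_mul _]
        simp_rw [integral_const_mul]
    _ ≤ ∑ j ∈ Icc 1 (2 * d), ‖nodeWeight (2 * d) j‖ * (2305 * (node (2 * d) j / N)) := by
        refine sum_le_sum fun j hj => ?_
        -- The weights may be negative; replacing them by their norms is allowed because the
        -- repeated means are nonnegative.
        exact mul_le_mul (Complex.re_le_norm _) (hnode j hj) (integral_repeatedMean_nonneg D C _)
          (norm_nonneg _)
    _ = 2305 / N * ∑ j ∈ Icc 1 (2 * d), ‖nodeWeight (2 * d) j‖ * node (2 * d) j := by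
        rw [mul_sum]
        exact sum_congr rfl fun j _ => by ring
    _ ≤ 2305 / N * (4 * Real.exp 20 * ((2 * d : ℕ) : ℝ) ^ 3) := by
        gcongr
        exact sum_norm_nodeWeight_mul_le _
    _ = 147520 * Real.exp 20 * ((d : ℝ) ^ 3 * (1 / 2) / N) := by
        push_cast; ring
    _ ≤ _ := by gcongr

end Expectation

end BlackBoxMoney

/-! ### The bound for the success probability -/

theorem theorem4p1 :
    ∃ κ : ℝ, 0 < κ ∧
      ∀ (t : ℕ) (D : MeasureTheory.Measure (Fin t → Circle)),
        MeasureTheory.IsProbabilityMeasure D →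
        (∀ n : ℕ, ∀ᵐ v ∂(MeasureTheory.Measure.pi fun _ : Fin n => D), Function.Injective v) →
        ∀ (N : ℕ) [NeZero N] (r m d : ℕ) (C : BlackBoxMoney.Circuit t N r m),
          2 ≤ d → C.queries ≤ d → (d : ℝ) ^ 3 < (N : ℝ) / (16 * Real.log N) →
          MeasureTheory.Integrable
              (fun ω => C.successProb (BlackBoxMoney.operators ω.1 ω.2))
              (BlackBoxMoney.instanceLaw D N) ∧
            ∫ ω, C.successProb (BlackBoxMoney.operators ω.1 ω.2)
                ∂(BlackBoxMoney.instanceLaw D N) ≤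
              κ * ((d : ℝ) ^ 3 * Real.log d / N) := by
  refine ⟨147520 * Real.exp 20, by positivity, ?_⟩
  intro t D hD hinj N _ r m d C hd hq hdN
  have hae : (fun ω : Matrix.orthogonalGroup (Fin N) ℝ × (Fin N → Fin t → Circle) =>
      C.successProb (BlackBoxMoney.operators ω.1 ω.2)) =ᵐ[BlackBoxMoney.instanceLaw D N]
      fun ω => BlackBoxMoney.tripleWeight ω.1.1 (C.output (BlackBoxMoney.operators ω.1 ω.2)) := by
    -- Distinctness of the samples serves only to replace the success probability by the continuous
    -- function `tripleWeight`, which also yields integrability; the estimates after this hold for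
    -- every `D`.
    have h : ∀ᵐ ω ∂(BlackBoxMoney.instanceLaw D N), Function.Injective ω.2 :=
      Measure.quasiMeasurePreserving_snd.ae (hinj N)
    filter_upwards [h] with ω hω
    exact BlackBoxMoney.successProb_eq_tripleWeight C ω.1 hω
  have hint := BlackBoxMoney.integrable_of_continuous_prod D
    (BlackBoxMoney.continuous_tripleWeight C)
  refine ⟨hint.congr hae.symm, ?_⟩
  rw [integral_congr_ae hae, BlackBoxMoney.instanceLaw, integral_prod _ hint]
  exact BlackBoxMoney.integral_tripleWeight_le D C hd hq hdN
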